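/- **Setting.** Let $V$ be a finite set, $G=(V,E)$ a directed acyclic graph (DAG) and $\Pi$ a partition of $V$; write $i\sim_\Pi j$ if $i,j$ lie in the same block. Let $$M_{G,\Pi}=\{(I-\Lambda)^{-T}\,\mathrm{diag}(\omega)\,(I-\Lambda)^{-1} : \Lambda\in\mathbb R^{V\times V},\ \lambda_{ij}=0 \text{ if } (i,j)\notin E,\ \omega\in(0,\infty)^V,\ \omega_i=\omega_j \text{ if } i\sim_\Pi j\}.$$ DAGs $G_1,G_2$ on $V$ are $\Pi$-model equivalent, $G_1\approx_\Pi G_2$, if $M_{G_1,\Pi}=M_{G_2,\Pi}$. The CPDAG $G^*_\Pi$ of $G$ under $\Pi$ is the union of all DAGs $G'$ on $V$ with $G'\approx_\Pi G$: it contains $i\to j$ iff some such $G'$ does. In such a mixed graph, a pair $i\to j$, $j\to i$ is regarded as one undirected edge $i-j$. **Orientation rules** for a mixed graph $H$ (letters denote distinct nodes; an arrow denotes a directed edge): - R1: if $a\to i - j$ and $a,j$ are not adjacent, orient $i\to j$. - R2: if $i\to a\to j$ and $i-j$, orient $i\to j$. - R3: if $i-j$, $i-a\to j$, $i-b\to j$,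 and $a,b$ are not adjacent, orient $i\to j$. **Algorithm 1** (input $G$, $\Pi$). 1. Let $G'$ be the mixed graph with the skeleton of $G$ in which exactly the edges of $G$ that occur in an unshielded collider triple $i\to j\leftarrow k$ ($i\neq k$, with $i,k$ not adjacent in $G$) are oriented, as in $G$; all other edges are undirected. 2. Apply R1, R2, R3 to $G'$, one at a time in any order, until none applies. 3. For each node $i$ in a block of $\Pi$ of size at least $2$ (in any order), give all edges of $G'$ with an endpoint at $i$ their orientation in $G$. 4. Apply R1 and R2 to $G'$, one at a time in any order, until neither applies. Return $G'$. **Theorem 4.3.** For every DAG $G$ and every partition $\Pi$ of its node set, every run of Algorithm 1 terminates, and every run returns the CPDAG $G^*_\Pi$. -/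

import Mathlib

namespace PartialHomoscedasticity

/-- A directed graph is a DAG if no node lies on a directed cycle (in particular, it has no
loops and no pair of opposite edges). -/
def IsDAG {V : Type*} (G : Digraph V) : Prop :=
  ∀ v, ¬ Relation.TransGen G.Adj v v

/-- The relation `i ∼ j`: the nodes `i` and `j` lie in the same block of the partition. -/
def SameBlock {V : Type*} [Fintype V] [DecidableEq V]
    (P : Finpartition (Finset.univ : Finset V)) (i j : V) : Prop :=
  ∃ B ∈ P.parts, i ∈ B ∧ j ∈ B

/-- The covariance parametrization `(Λ, ω) ↦ (I - Λ)⁻ᵀ diag(ω) (I - Λ)⁻¹`. -/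
noncomputable def covParam {V : Type*} [Fintype V] [DecidableEq V]
    (L : Matrix V V ℝ) (w : V → ℝ) : Matrix V V ℝ :=
  ((1 - L)⁻¹).transpose * Matrix.diagonal w * (1 - L)⁻¹

/-- The set of covariance matrices of the partially homoscedastic linear Gaussian model given
by a directed graph and a partition: the coefficient matrix is supported on the edges, the error
variances are positive, and they are equal within each block. -/
def covModel {V : Type*} [Fintype V] [DecidableEq V]
    (G : Digraph V) (P : Finpartition (Finset.univ : Finset V)) : Set (Matrix V V ℝ) :=
  {S | ∃ (L : Matrix V V ℝ) (w : V → ℝ),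
    (∀ i j, ¬ G.Adj i j → L i j = 0) ∧
    (∀ i, 0 < w i) ∧
    (∀ i j, SameBlock P i j → w i = w j) ∧
    S = covParam L w}

/-- Two directed graphs are model equivalent with respect to the partition `P`. -/
def ModelEquiv {V : Type*} [Fintype V] [DecidableEq V]
    (P : Finpartition (Finset.univ : Finset V)) (G₁ G₂ : Digraph V) : Prop :=
  covModel G₁ P = covModel G₂ P

/-- The CPDAG of `G` under the partition `P`: the union of all DAGs on `V` that are model
equivalent to `G`. A pair of opposite edges represents an undirected edge. -/
def cpdag {V : Type*} [Fintype V] [DecidableEq V]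
    (G : Digraph V) (P : Finpartition (Finset.univ : Finset V)) : Digraph V :=
  sSup {G' | IsDAG G' ∧ ModelEquiv P G' G}

section MixedGraphs

/-! Mixed graphs are encoded as digraphs: an undirected edge is a pair of opposite edges. -/

variable {V : Type*}

/-- `i → j` is a directed edge of the mixed graph `H`. -/
def DirEdge (H : Digraph V) (i j : V) : Prop := H.Adj i j ∧ ¬ H.Adj j i

/-- `i - j` is an undirected edge of the mixed graph `H`. -/
def UndirEdge (H : Digraph V) (i j : V) : Prop := H.Adj i j ∧ H.Adj j i

/-- There is an edge of some kind between `i` and `j`. -/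
def Adjacent (H : Digraph V) (i j : V) : Prop := H.Adj i j ∨ H.Adj j i

/-- `i → j ← k` is an unshielded collider triple: its distinct endpoints are not adjacent. -/
def UnshieldedCollider (G : Digraph V) (i j k : V) : Prop :=
  G.Adj i j ∧ G.Adj k j ∧ i ≠ k ∧ ¬ Adjacent G i k

/-- The mixed graph with the skeleton of `G` in which exactly the edges that occur in an
unshielded collider triple of `G` are oriented (as in `G`). -/
def patternGraph (G : Digraph V) : Digraph V where
  Adj i j := G.Adj i j ∨ (G.Adj j i ∧ ¬ ∃ k, UnshieldedCollider G j i k)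

/-- Orient the undirected edge `i - j` as `i → j`, by deleting the opposite edge. -/
def orient (H : Digraph V) (i j : V) : Digraph V where
  Adj a b := H.Adj a b ∧ ¬ (a = j ∧ b = i)

/-- Rule R1 applies to the undirected edge `i - j` and orients it as `i → j`:
`a → i - j` with `a` and `j` not adjacent. -/
def RuleR1 (H : Digraph V) (i j : V) : Prop :=
  UndirEdge H i j ∧ ∃ a, DirEdge H a i ∧ ¬ Adjacent H a j

/-- Rule R2 applies to the undirected edge `i - j` and orients it as `i → j`: `i → a → j`. -/
def RuleR2 (H : Digraph V) (i j : V) : Prop :=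
  UndirEdge H i j ∧ ∃ a, DirEdge H i a ∧ DirEdge H a j

/-- Rule R3 applies to the undirected edge `i - j` and orients it as `i → j`:
`i - a → j` and `i - b → j` with `a` and `b` distinct and not adjacent. -/
def RuleR3 (H : Digraph V) (i j : V) : Prop :=
  UndirEdge H i j ∧ ∃ a b, a ≠ b ∧ ¬ Adjacent H a b ∧
    UndirEdge H i a ∧ UndirEdge H i b ∧ DirEdge H a j ∧ DirEdge H b j

/-- `H'` arises from `H` by one application of R1, R2 or R3. -/
def StepR123 (H H' : Digraph V) : Prop :=
  ∃ i j, (RuleR1 H i j ∨ RuleR2 H i j ∨ RuleR3 H i j) ∧ H' = orient H i j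

/-- `H'` arises from `H` by one application of R1 or R2. -/
def StepR12 (H H' : Digraph V) : Prop :=
  ∃ i j, (RuleR1 H i j ∨ RuleR2 H i j) ∧ H' = orient H i j

/-- Replace, in `H`, the orientations of all edges with one endpoint at `v` by those in `G`. -/
def copyAt (G H : Digraph V) (v : V) : Digraph V where
  Adj a b := ((a = v ∨ b = v) ∧ G.Adj a b) ∨ (a ≠ v ∧ b ≠ v ∧ H.Adj a b)

end MixedGraphs

/-- The nodes that belong to a block of size at least two. -/
def bigBlockNodes {V : Type*} [Fintype V] [DecidableEq V]
    (P : Finpartition (Finset.univ : Finset V)) : Finset V :=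
  {i | ∃ B ∈ P.parts, i ∈ B ∧ 2 ≤ B.card}

/-- The states of the algorithm. -/
inductive AlgState (V : Type*) where
  /-- the start, before anything has been computed -/
  | start : AlgState V
  /-- applying R1, R2, R3 to the current mixed graph `H` -/
  | phase1 (H : Digraph V) : AlgState V
  /-- copying orientations at nodes; `S` is the set of nodes still to be processed -/
  | loop (S : Finset V) (H : Digraph V) : AlgState V
  /-- applying R1, R2 to the current mixed graph `H` -/
  | phase2 (H : Digraph V) : AlgState V
  /-- the algorithm has returned `H` -/
  | output (H : Digraph V) : AlgState V

/-- One step of the algorithm on the input `(G, P)`. The choice of the edge oriented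
next and of the node processed next is nondeterministic. -/
inductive AlgStep {V : Type*} [Fintype V] [DecidableEq V]
    (G : Digraph V) (P : Finpartition (Finset.univ : Finset V)) :
    AlgState V → AlgState V → Prop where
  | init : AlgStep G P .start (.phase1 (patternGraph G))
  | orient1 (H H' : Digraph V) (h : StepR123 H H') : AlgStep G P (.phase1 H) (.phase1 H')
  | end1 (H : Digraph V) (h : ∀ H', ¬ StepR123 H H') :
      AlgStep G P (.phase1 H) (.loop (bigBlockNodes P) H)
  | copy (S : Finset V) (H : Digraph V) (v : V) (hv : v ∈ S) :
      AlgStep G P (.loop S H) (.loop (S.erase v) (copyAt G H v))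
  | endLoop (H : Digraph V) : AlgStep G P (.loop ∅ H) (.phase2 H)
  | orient2 (H H' : Digraph V) (h : StepR12 H H') : AlgStep G P (.phase2 H) (.phase2 H')
  | ret (H : Digraph V) (h : ∀ H', ¬ StepR12 H H') : AlgStep G P (.phase2 H) (.output H)

/-- Every run of the algorithm on `(G, P)` is finite. -/
def Terminates {V : Type*} [Fintype V] [DecidableEq V]
    (G : Digraph V) (P : Finpartition (Finset.univ : Finset V)) : Prop :=
  Acc (fun t s => AlgStep G P s t) AlgState.start

/-- `s` is a final state of some run of the algorithm on `(G, P)`: it is reachable from the start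
and no further step is possible. -/
def FinalState {V : Type*} [Fintype V] [DecidableEq V]
    (G : Digraph V) (P : Finpartition (Finset.univ : Finset V)) (s : AlgState V) : Prop :=
  Relation.ReflTransGen (AlgStep G P) AlgState.start s ∧ ∀ t, ¬ AlgStep G P s t

end PartialHomoscedasticity

/-!
Two DAGs are model equivalent exactly if they have the same skeleton, the same unshielded
colliders and the same edges at every node that shares its block with another node
(`modelEquiv_iff`). Necessity is seen by testing the models on a single edge and on a single
collider with unit weights: for a fixed order of the nodes, the triangular factorization of a
precision matrix is unique (`prec_injective`), so these matrices have computable parameters in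
the second model, and the edges of the second graph and the equality of variances can be read
off. For sufficiency, reversing a covered edge between nodes in blocks of size one does not change
the model (`covModel_revEdge`), and equivalent DAGs are connected by such reversals
(`covModel_eq_of_graphEquiv`).

The algorithm is sound because each rule orients an edge in the only way that is compatible with
acyclicity and the given colliders (`Sound.orient_of_rule`). For completeness, the key is the
chain property: `a → b - c` implies `a → c`. A violation would be a triangle `a → b - c - a`, and
the reason for the orientation of `a → b` produces a triangle whose head is earlier in a
topological order, or an edge to which a rule still applies. This works after the first phase
(`PatternPhase.chainProperty`). It still works after the second one with only R1 and R2
(`CopyPhase.chainProperty`), because copying directs all edges at the chosen nodes.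

Given the chain property, the undirected part is a chordal graph, and orienting it along any of its
perfect orders gives an equivalent DAG. A chordal graph has a perfect order that starts at any
given node (`exists_perfectOn_first`), so each undirected edge occurs in both directions in
equivalent DAGs and the output is the CPDAG (`Sound.eq_cpdag`). Termination follows from a
decreasing measure.
-/

namespace PartialHomoscedasticity

open Relation Matrix

/-! ### Topological ranks -/

lemma exists_rank {V : Type*} [Fintype V] {G : Digraph V} (hG : IsDAG G) :
    ∃ f : V → ℕ, Function.Injective f ∧ ∀ a b, G.Adj a b → f a < f b := by
  classical
  let c : V → ℕ := fun v => (Finset.univ.filter (fun u => TransGen G.Adj u v)).card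
  let e : V → ℕ := fun v => (Fintype.equivFin V v : ℕ)
  have he : ∀ v, e v < Fintype.card V := fun v => (Fintype.equivFin V v).2
  -- the number of ancestors, with ties broken by an arbitrary enumeration
  refine ⟨fun v => Fintype.card V * c v + e v, fun a b h => ?_, fun a b h => ?_⟩
  · have h1 := congrArg (· % Fintype.card V) h
    simp only [Nat.mul_add_mod, Nat.mod_eq_of_lt (he _)] at h1
    exact (Fintype.equivFin V).injective (Fin.ext h1)
  · have hc : c a < c b := by
      refine Finset.card_lt_card (Finset.ssubset_iff_of_subset ?_ |>.2 ⟨a, ?_, ?_⟩)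
      · intro u hu
        simp only [Finset.mem_filter, Finset.mem_univ, true_and] at hu ⊢
        exact hu.tail h
      · simpa using TransGen.single h
      · simpa using hG a
    have := he a
    show Fintype.card V * c a + e a < Fintype.card V * c b + e b
    nlinarith

/-! ### Precision matrices -/

section Precision

variable {V : Type*} [DecidableEq V]

/-- The precision matrix `(I - Λ) diag(ω)⁻¹ (I - Λ)ᵀ`, the inverse of the covariance matrix
`covParam Λ ω`. It is polynomial in `Λ`, which makes it easier to compute with. -/
noncomputable def prec [Fintype V] (L : Matrix V V ℝ) (w : V → ℝ) : Matrix V V ℝ :=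
  (1 - L) * diagonal (fun v => (w v)⁻¹) * (1 - L)ᵀ

lemma prec_apply [Fintype V] (L : Matrix V V ℝ) (w : V → ℝ) (a b : V) :
    prec L w a b = ∑ v, (1 - L) a v * (w v)⁻¹ * (1 - L) b v := by
  rw [prec, mul_apply]
  simp only [mul_diagonal, transpose_apply]

lemma det_one_sub_ne_zero [Fintype V] {L : Matrix V V ℝ} {f : V → ℕ}
    (hL : ∀ a b, L a b ≠ 0 → f a < f b) : (1 - L).det ≠ 0 := by
  intro h0
  obtain ⟨x, hx, hx0⟩ := Matrix.exists_mulVec_eq_zero_iff.2 h0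
  obtain ⟨a0, ha0⟩ := Function.ne_iff.1 hx
  -- a node of largest rank in the support of a kernel vector
  obtain ⟨a, ha, hmax⟩ := Finset.exists_max_image (Finset.univ.filter (fun a => x a ≠ 0)) f
    ⟨a0, by simpa using ha0⟩
  simp only [Finset.mem_filter, Finset.mem_univ, true_and] at ha hmax
  have h1 := congrFun hx0 a
  rw [sub_mulVec, one_mulVec] at h1
  have h2 : (L *ᵥ x) a = 0 := by
    refine Finset.sum_eq_zero fun b _ => ?_
    by_contra hb
    exact absurd (hmax b (right_ne_zero_of_mul hb)) (not_le.2 (hL a b (left_ne_zero_of_mul hb)))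
  simp only [Pi.sub_apply, h2, sub_zero, Pi.zero_apply] at h1
  exact ha h1

lemma covParam_eq_inv [Fintype V] (L : Matrix V V ℝ) {w : V → ℝ} (hw : ∀ v, 0 < w v) :
    covParam L w = (prec L w)⁻¹ := by
  have hd : (diagonal (fun v => (w v)⁻¹))⁻¹ = diagonal w := by
    refine inv_eq_right_inv ?_
    rw [diagonal_mul_diagonal, ← diagonal_one]
    exact congrArg _ (funext fun v => inv_mul_cancel₀ (hw v).ne')
  rw [covParam, prec, Matrix.mul_inv_rev, Matrix.mul_inv_rev, hd, transpose_nonsing_inv,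
    Matrix.mul_assoc]

lemma prec_eq_of_covParam_eq [Fintype V] {L L' : Matrix V V ℝ} {w w' : V → ℝ} {f f' : V → ℕ}
    (hL : ∀ a b, L a b ≠ 0 → f a < f b) (hL' : ∀ a b, L' a b ≠ 0 → f' a < f' b)
    (hw : ∀ v, 0 < w v) (hw' : ∀ v, 0 < w' v) (h : covParam L w = covParam L' w') :
    prec L w = prec L' w' := by
  have key : ∀ {L : Matrix V V ℝ} {w : V → ℝ} {f : V → ℕ},
      (∀ a b, L a b ≠ 0 → f a < f b) → (∀ v, 0 < w v) → IsUnit (prec L w).det := by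
    intro L w f hL hw
    rw [isUnit_iff_ne_zero, prec, det_mul, det_mul, det_transpose, det_diagonal]
    have h1 := det_one_sub_ne_zero hL
    have h2 : ∏ v, (w v)⁻¹ ≠ 0 := Finset.prod_ne_zero_iff.2 fun v _ => inv_ne_zero (hw v).ne'
    exact mul_ne_zero (mul_ne_zero h1 h2) h1
  rw [covParam_eq_inv L hw, covParam_eq_inv L' hw'] at h
  rw [← nonsing_inv_nonsing_inv _ (key hL hw), h, nonsing_inv_nonsing_inv _ (key hL' hw')]

/-- Uniqueness of the triangular decomposition of a precision matrix for a given order of the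
nodes: the columns are determined one after the other, from the last node to the first. -/
lemma prec_injective [Fintype V] {L L' : Matrix V V ℝ} {w w' : V → ℝ} {f : V → ℕ}
    (hL : ∀ a b, L a b ≠ 0 → f a < f b) (hL' : ∀ a b, L' a b ≠ 0 → f a < f b)
    (hw' : ∀ v, 0 < w' v) (h : prec L w = prec L' w') :
    L = L' ∧ w = w' := by
  have zero : ∀ {L : Matrix V V ℝ}, (∀ a b, L a b ≠ 0 → f a < f b) →
      ∀ a b, ¬ f a < f b → L a b = 0 := fun hL a b hab => not_not.1 fun h0 => hab (hL a b h0)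
  have key : ∀ z, (∀ a, L a z = L' a z) ∧ w z = w' z := by
    intro z
    induction hn : (Finset.univ.sup f) - f z using Nat.strong_induction_on generalizing z with
    | _ n ih =>
    subst hn
    have hz : ∀ a, (1 - L) a z * (w z)⁻¹ = (1 - L') a z * (w' z)⁻¹ := by
      intro a
      have hs := congrFun (congrFun h a) z
      rw [prec_apply, prec_apply, ← Finset.add_sum_erase _ _ (Finset.mem_univ z),
        ← Finset.add_sum_erase _ _ (Finset.mem_univ z)] at hs
      have he : ∀ v ∈ Finset.univ.erase z, (1 - L) a v * (w v)⁻¹ * (1 - L) z v =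
          (1 - L') a v * (w' v)⁻¹ * (1 - L') z v := by
        intro v hv
        have hvz : v ≠ z := Finset.ne_of_mem_erase hv
        rcases lt_or_ge (f z) (f v) with hlt | hge
        · have hle : f v ≤ Finset.univ.sup f := Finset.le_sup (Finset.mem_univ v)
          obtain ⟨h1, h2⟩ := ih _ (by omega) v rfl
          simp only [Matrix.sub_apply, h1, h2]
        · simp [Matrix.sub_apply, one_apply, hvz.symm, zero hL z v hge.not_gt,
            zero hL' z v hge.not_gt]
      rw [Finset.sum_congr rfl he] at hs
      have := add_right_cancel hs
      simpa [Matrix.sub_apply, zero hL z z (lt_irrefl _), zero hL' z z (lt_irrefl _)] using this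
    have hwz : w z = w' z := by
      have := hz z
      simpa [Matrix.sub_apply, zero hL z z (lt_irrefl _), zero hL' z z (lt_irrefl _)] using this
    refine ⟨fun a => ?_, hwz⟩
    have := hz a
    rw [hwz] at this
    have := mul_right_cancel₀ (inv_ne_zero (hw' z).ne') this
    simpa [Matrix.sub_apply] using this
  exact ⟨by ext a z; exact (key z).1 a, funext fun z => (key z).2⟩

/-! ### Reversing one edge at the level of parameters -/

/-- The coefficient matrix obtained from `L` by exchanging the order of `i` and `j`. In terms of
the columns `c` of `I - L`, the new columns are `c_j' = c_j + a c_i` and `c_i' = c_i - b c_j'`,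
where `a = L i j` and where `b` makes the mixed terms of the precision matrix agree. -/
noncomputable def revCoeff (L : Matrix V V ℝ) (w : V → ℝ) (i j : V) : Matrix V V ℝ :=
  1 - Matrix.of fun z v =>
    if v = j then (1 - L) z j + L i j * (1 - L) z i
    else if v = i then (1 - L) z i - L i j * w i / (w j + L i j ^ 2 * w i) *
      ((1 - L) z j + L i j * (1 - L) z i)
    else (1 - L) z v

/-- The error variances that belong to `revCoeff`. -/
noncomputable def revVar (L : Matrix V V ℝ) (w : V → ℝ) (i j : V) : V → ℝ := fun v =>
  if v = j then w j + L i j ^ 2 * w i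
  else if v = i then w i * w j / (w j + L i j ^ 2 * w i) else w v

variable {L : Matrix V V ℝ} {w : V → ℝ} {i j : V}

lemma revVar_pos (hw : ∀ v, 0 < w v) (v : V) : 0 < revVar L w i j v := by
  have := hw i; have := hw j; have := hw v
  unfold revVar
  split_ifs <;> positivity

lemma prec_rev [Fintype V] (hw : ∀ v, 0 < w v) (hij : i ≠ j) :
    prec (revCoeff L w i j) (revVar L w i j) = prec L w := by
  ext a b
  have hj : j ∈ Finset.univ.erase i := Finset.mem_erase.2 ⟨hij.symm, Finset.mem_univ j⟩
  simp only [prec_apply, ← Finset.add_sum_erase _ _ (Finset.mem_univ i),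
    ← Finset.add_sum_erase _ _ hj]
  rw [← add_assoc, ← add_assoc]
  congr 1
  · have := hw i; have := hw j
    have : 0 < w j + L i j ^ 2 * w i := by positivity
    simp only [revCoeff, revVar, sub_sub_cancel, of_apply, if_pos, if_neg hij]
    generalize (1 - L) a i = p
    generalize (1 - L) a j = q
    generalize (1 - L) b i = r
    generalize (1 - L) b j = s
    field_simp
    ring
  · refine Finset.sum_congr rfl fun v hv => ?_
    have h1 : v ≠ j := Finset.ne_of_mem_erase hv
    have h2 : v ≠ i := Finset.ne_of_mem_erase (Finset.mem_of_mem_erase hv)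
    simp only [revCoeff, revVar, sub_sub_cancel, of_apply, if_neg h1, if_neg h2]

lemma revCoeff_of_ne {z v : V} (hj : v ≠ j) (hi : v ≠ i) : revCoeff L w i j z v = L z v := by
  simp [revCoeff, hj, hi]

lemma revCoeff_tail (hii : L i i = 0) : revCoeff L w i j i j = 0 := by
  by_cases hij : i = j
  · subst hij; simp [revCoeff, hii]
  · simp [revCoeff, one_apply, hij, hii]

lemma revCoeff_right {z : V} (hz : z ≠ i) : revCoeff L w i j z j = L z j + L i j * L z i := by
  simp only [revCoeff, Matrix.sub_apply, of_apply, if_pos, one_apply, if_neg hz]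
  ring

lemma revCoeff_head (hij : i ≠ j) (hji : L j i = 0) (hjj : L j j = 0) :
    revCoeff L w i j j i = L i j * w i / (w j + L i j ^ 2 * w i) := by
  simp [revCoeff, one_apply, hij, hij.symm, hji, hjj]

lemma revCoeff_diag (hij : i ≠ j) (hii : L i i = 0) : revCoeff L w i j i i = 0 := by
  simp [revCoeff, one_apply, hij, hii]

lemma revCoeff_left {z : V} (hij : i ≠ j) (hzi : z ≠ i) (hzj : z ≠ j) :
    revCoeff L w i j z i =
      L z i - L i j * w i / (w j + L i j ^ 2 * w i) * (L z j + L i j * L z i) := by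
  simp only [revCoeff, Matrix.sub_apply, of_apply, if_pos, one_apply, if_neg hij, if_neg hzi,
    if_neg hzj]
  ring

lemma revCoeff_support (hij : i ≠ j) (hii : L i i = 0) {a b : V}
    (h : revCoeff L w i j a b ≠ 0) :
    (a = j ∧ b = i) ∨ (b ≠ i ∧ b ≠ j ∧ L a b ≠ 0) ∨
      ((b = i ∨ b = j) ∧ a ≠ i ∧ (L a i ≠ 0 ∨ L a j ≠ 0)) := by
  by_cases hbj : b = j
  · subst hbj
    have hai : a ≠ i := by rintro rfl; exact h (revCoeff_tail hii)
    rw [revCoeff_right hai] at h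
    refine Or.inr (Or.inr ⟨Or.inr rfl, hai, ?_⟩)
    by_contra! h0
    exact h (by rw [h0.1, h0.2]; ring)
  by_cases hbi : b = i
  · subst hbi
    by_cases haj : a = j
    · exact Or.inl ⟨haj, rfl⟩
    have hab : a ≠ b := by rintro rfl; exact h (revCoeff_diag hij hii)
    rw [revCoeff_left hij hab haj] at h
    refine Or.inr (Or.inr ⟨Or.inl rfl, hab, ?_⟩)
    by_contra! h0
    exact h (by rw [h0.1, h0.2]; ring)
  · rw [revCoeff_of_ne hbj hbi] at h
    exact Or.inr (Or.inl ⟨hbi, hbj, h⟩)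

end Precision

/-! ### Reversal of covered edges -/

section CoveredEdges

variable {V : Type*}

lemma IsDAG.irrefl {G : Digraph V} (hG : IsDAG G) (a : V) : ¬ G.Adj a a :=
  fun h => hG a (.single h)

lemma IsDAG.asymm {G : Digraph V} (hG : IsDAG G) {a b : V} (h : G.Adj a b) : ¬ G.Adj b a :=
  fun h' => hG a (.tail (.single h) h')

lemma IsDAG.ne {G : Digraph V} (hG : IsDAG G) {a b : V} (h : G.Adj a b) : a ≠ b := by
  rintro rfl; exact hG.irrefl _ h

lemma IsDAG.no_triangle {G : Digraph V} (hG : IsDAG G) {a b c : V} (h : G.Adj a b)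
    (h' : G.Adj b c) : ¬ G.Adj c a :=
  fun h'' => hG a (.tail (.tail (.single h) h') h'')

/-- The edge `i → j` is covered if `j` has the same parents as `i`, apart from `i` itself. -/
def CoveredEdge (G : Digraph V) (i j : V) : Prop :=
  G.Adj i j ∧ ∀ z, z ≠ i → (G.Adj z j ↔ G.Adj z i)

/-- The graph `G` with the edge `i → j` replaced by `j → i`. -/
def revEdge (G : Digraph V) (i j : V) : Digraph V where
  Adj a b := (G.Adj a b ∧ ¬ (a = i ∧ b = j)) ∨ (a = j ∧ b = i)

variable {G : Digraph V} {i j : V}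

lemma isDAG_revEdge (hG : IsDAG G) (hc : CoveredEdge G i j) : IsDAG (revEdge G i j) := by
  let R : V → V → Prop := fun a b => G.Adj a b ∧ ¬ (a = i ∧ b = j)
  have hR : ∀ {a b}, TransGen R a b → TransGen G.Adj a b :=
    fun h => TransGen.mono (fun _ _ h => h.1) _ _ h
  have hR' : ∀ {a b}, ReflTransGen R a b → ReflTransGen G.Adj a b :=
    fun h => ReflTransGen.mono (fun _ _ h => h.1) _ _ h
  -- a path in the new graph avoids the new edge or passes through it
  have key : ∀ {a b}, TransGen (revEdge G i j).Adj a b →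
      TransGen R a b ∨ (ReflTransGen R a j ∧ ReflTransGen R i b) := by
    intro a b h
    induction h with
    | single h =>
      rcases h with h | ⟨rfl, rfl⟩
      · exact Or.inl (.single h)
      · exact Or.inr ⟨.refl, .refl⟩
    | tail _ h ih =>
      rcases h with h | ⟨rfl, rfl⟩
      · rcases ih with ih | ⟨h1, h2⟩
        · exact Or.inl (ih.tail h)
        · exact Or.inr ⟨h1, h2.tail h⟩
      · rcases ih with ih | ⟨h1, h2⟩
        · exact Or.inr ⟨ih.to_reflTransGen, .refl⟩
        · exact Or.inr ⟨h1, .refl⟩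
  intro v hv
  rcases key hv with h | ⟨h1, h2⟩
  · exact hG v (hR h)
  · rcases ReflTransGen.cases_tail (h2.trans h1) with h | ⟨z, hz, hzj⟩
    · exact hG.ne hc.1 h.symm
    · have hzi : z ≠ i := fun h => hzj.2 ⟨h, rfl⟩
      exact hG i (TransGen.tail' (hR' hz) ((hc.2 z hzi).1 hzj.1))

lemma coveredEdge_revEdge (hG : IsDAG G) (hc : CoveredEdge G i j) :
    CoveredEdge (revEdge G i j) j i := by
  refine ⟨Or.inr ⟨rfl, rfl⟩, fun z hz => ?_⟩
  have hij := hG.ne hc.1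
  have := hc.2 z
  have := hG.irrefl i
  simp only [revEdge]
  grind

lemma revEdge_revEdge (hG : IsDAG G) (hc : G.Adj i j) : revEdge (revEdge G i j) j i = G := by
  have := hG.asymm hc
  ext a b
  simp only [revEdge]
  grind

lemma adjacent_revEdge_iff (hc : G.Adj i j) (a b : V) :
    Adjacent (revEdge G i j) a b ↔ Adjacent G a b := by
  simp only [Adjacent, revEdge]
  grind

lemma unshieldedCollider_revEdge (hc : CoveredEdge G i j) {a b c : V}
    (h : UnshieldedCollider G a b c) : UnshieldedCollider (revEdge G i j) a b c := by
  obtain ⟨h1, h2, hne, hn⟩ := h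
  refine ⟨Or.inl ⟨h1, ?_⟩, Or.inl ⟨h2, ?_⟩, hne, by rwa [adjacent_revEdge_iff hc.1]⟩
  · rintro ⟨rfl, rfl⟩
    exact hn (Or.inr ((hc.2 c hne.symm).1 h2))
  · rintro ⟨rfl, rfl⟩
    exact hn (Or.inl ((hc.2 a hne).1 h1))

lemma unshieldedCollider_revEdge_iff (hG : IsDAG G) (hc : CoveredEdge G i j) (a b c : V) :
    UnshieldedCollider (revEdge G i j) a b c ↔ UnshieldedCollider G a b c := by
  refine ⟨fun h => ?_, unshieldedCollider_revEdge hc⟩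
  have := unshieldedCollider_revEdge (coveredEdge_revEdge hG hc) h
  rwa [revEdge_revEdge hG hc.1] at this

variable [Fintype V] [DecidableEq V] {P : Finpartition (Finset.univ : Finset V)}

lemma SameBlock.symm {i j : V} (h : SameBlock P i j) : SameBlock P j i :=
  let ⟨B, hB, h1, h2⟩ := h; ⟨B, hB, h2, h1⟩

lemma SameBlock.eq_of_notMem {i j : V} (h : SameBlock P i j) (hi : i ∉ bigBlockNodes P) :
    j = i := by
  obtain ⟨B, hB, h1, h2⟩ := h
  by_contra hne
  exact hi (by
    simp only [bigBlockNodes, Finset.mem_filter, Finset.mem_univ, true_and]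
    exact ⟨B, hB, h1, Finset.one_lt_card.2 ⟨j, h2, i, h1, hne⟩⟩)

lemma exists_sameBlock_ne {i : V} (hi : i ∈ bigBlockNodes P) : ∃ j, j ≠ i ∧ SameBlock P i j := by
  simp only [bigBlockNodes, Finset.mem_filter, Finset.mem_univ, true_and] at hi
  obtain ⟨B, hB, h1, h2⟩ := hi
  obtain ⟨j, hj, hne⟩ := Finset.exists_mem_ne h2 i
  exact ⟨j, hne, B, hB, h1, hj⟩

lemma covModel_subset_revEdge (hG : IsDAG G) (hc : CoveredEdge G i j)
    (hi : i ∉ bigBlockNodes P) (hj : j ∉ bigBlockNodes P) :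
    covModel G P ⊆ covModel (revEdge G i j) P := by
  rintro S ⟨L, w, hL, hw, hb, rfl⟩
  have hij := hG.ne hc.1
  have hL' : ∀ a b, L a b ≠ 0 → G.Adj a b := fun a b h => not_not.1 fun h' => h (hL a b h')
  refine ⟨revCoeff L w i j, revVar L w i j, fun a b => ?_, revVar_pos hw, fun a b hab => ?_, ?_⟩
  · refine fun h => not_not.1 (mt (fun h0 => ?_) h)
    rcases revCoeff_support hij (hL i i (hG.irrefl i)) h0 with h1 | ⟨h1, h2, h3⟩ | ⟨h1, h2, h3⟩
    · exact Or.inr h1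
    · exact Or.inl ⟨hL' _ _ h3, fun h => h2 h.2⟩
    · have h4 : G.Adj a i := h3.elim (hL' _ _) fun h => (hc.2 a h2).1 (hL' _ _ h)
      refine Or.inl ⟨?_, fun h => h2 h.1⟩
      rcases h1 with rfl | rfl
      · exact h4
      · exact (hc.2 a h2).2 h4
  · have h1 := hb a b hab
    by_cases ha : a ∈ bigBlockNodes P
    · have hbb : b ∈ bigBlockNodes P := by
        by_contra hbb
        exact hbb (hab.symm.eq_of_notMem hbb ▸ ha)
      have : ∀ x, x ∈ bigBlockNodes P → revVar L w i j x = w x := by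
        intro x hx
        have h1 : x ≠ i := by rintro rfl; exact hi hx
        have h2 : x ≠ j := by rintro rfl; exact hj hx
        simp [revVar, h1, h2]
      rw [this a ha, this b hbb, h1]
    · rw [hab.eq_of_notMem ha]
  · rw [covParam_eq_inv L hw, covParam_eq_inv _ (revVar_pos hw), prec_rev hw hij]

lemma covModel_revEdge (hG : IsDAG G) (hc : CoveredEdge G i j)
    (hi : i ∉ bigBlockNodes P) (hj : j ∉ bigBlockNodes P) :
    covModel (revEdge G i j) P = covModel G P := by
  refine Set.Subset.antisymm ?_ (covModel_subset_revEdge hG hc hi hj)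
  have := covModel_subset_revEdge (isDAG_revEdge hG hc) (coveredEdge_revEdge hG hc) hj hi
  rwa [revEdge_revEdge hG hc.1] at this

end CoveredEdges

/-! ### Graphical characterization of model equivalence -/

section ModelEquivalence

variable {V : Type*} [Fintype V] [DecidableEq V] {P : Finpartition (Finset.univ : Finset V)}

/-- Two directed graphs have the same skeleton, the same unshielded colliders and the same
edges at all nodes that share their block with another node. For DAGs this describes model
equivalence, see `modelEquiv_iff`. -/
structure GraphEquiv (P : Finpartition (Finset.univ : Finset V)) (G₁ G₂ : Digraph V) : Prop where
  adjacent_iff : ∀ a b, Adjacent G₁ a b ↔ Adjacent G₂ a b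
  collider_iff : ∀ a b c, UnshieldedCollider G₁ a b c ↔ UnshieldedCollider G₂ a b c
  adj_iff : ∀ a b, a ∈ bigBlockNodes P ∨ b ∈ bigBlockNodes P → (G₁.Adj a b ↔ G₂.Adj a b)

lemma GraphEquiv.symm {G₁ G₂ : Digraph V} (h : GraphEquiv P G₁ G₂) : GraphEquiv P G₂ G₁ :=
  ⟨fun a b => (h.1 a b).symm, fun a b c => (h.2 a b c).symm, fun a b hab => (h.3 a b hab).symm⟩

/-- Chickering's transformation: equivalent DAGs are connected by reversals of covered edges.
Among the edges oriented differently in the two graphs, the one with the first possible head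
and, for this head, the last possible tail is covered. -/
lemma covModel_eq_of_graphEquiv {D D' : Digraph V} (hD : IsDAG D) (hD' : IsDAG D')
    (h : GraphEquiv P D D') : covModel D P = covModel D' P := by
  classical
  induction hn : (Finset.univ.filter
    (fun p : V × V => D.Adj p.1 p.2 ∧ D'.Adj p.2 p.1)).card using Nat.strong_induction_on
    generalizing D with
  | _ n ih =>
  subst hn
  by_cases hE : ∃ a b, D.Adj a b ∧ D'.Adj b a
  · obtain ⟨f, -, hf⟩ := exists_rank hD
    obtain ⟨a, b, hab⟩ := hE
    obtain ⟨y, hy, hymin⟩ := Finset.exists_min_image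
      (Finset.univ.filter (fun y => ∃ x, D.Adj x y ∧ D'.Adj y x)) f ⟨b, by simpa using ⟨a, hab⟩⟩
    simp only [Finset.mem_filter, Finset.mem_univ, true_and, forall_exists_index] at hy hymin
    obtain ⟨x0, hx0⟩ := hy
    obtain ⟨x, hx, hxmax⟩ := Finset.exists_max_image
      (Finset.univ.filter (fun x => D.Adj x y ∧ D'.Adj y x)) f ⟨x0, by simpa using hx0⟩
    simp only [Finset.mem_filter, Finset.mem_univ, true_and] at hx hxmax
    obtain ⟨hxy, hyx⟩ := hx
    -- an edge of `D` with head before `y` has the same orientation in `D'`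
    have hsame : ∀ u v, D.Adj u v → f v < f y → D'.Adj u v := by
      intro u v huv hv
      refine ((h.1 u v).1 (Or.inl huv)).resolve_right fun hvu => ?_
      exact absurd (hymin v u ⟨huv, hvu⟩) (not_le.2 hv)
    have hc : CoveredEdge D x y := by
      refine ⟨hxy, fun z hzx => ⟨fun hzy => ?_, fun hzx' => ?_⟩⟩
      · have hadj : Adjacent D z x := by
          by_contra hn
          have := (h.2 z y x).1 ⟨hzy, hxy, hzx, hn⟩
          exact hD'.asymm this.2.1 hyx
        refine hadj.resolve_right fun hxz => ?_
        have hxz' := hsame x z hxz (hf _ _ hzy)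
        have hzy' : D'.Adj z y := by
          refine ((h.1 z y).1 (Or.inl hzy)).resolve_right fun hyz => ?_
          exact absurd (hxmax z ⟨hzy, hyz⟩) (not_le.2 (hf _ _ hxz))
        exact hD'.no_triangle hxz' hzy' hyx
      · have hzx2 := hsame z x hzx' (hf _ _ hxy)
        have hzy : z ≠ y := by rintro rfl; exact hD.asymm hxy hzx'
        have hadj : Adjacent D z y := by
          by_contra hn
          have := (h.2 z x y).2 ⟨hzx2, hyx, hzy, fun h' => hn ((h.1 z y).2 h')⟩
          exact hD.asymm this.2.1 hxy
        exact hadj.resolve_right fun hyz => hD.no_triangle hxy hyz hzx'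
    have hxb : x ∉ bigBlockNodes P := fun hb =>
      hD'.asymm ((h.3 x y (Or.inl hb)).1 hxy) hyx
    have hyb : y ∉ bigBlockNodes P := fun hb =>
      hD'.asymm ((h.3 x y (Or.inr hb)).1 hxy) hyx
    rw [← covModel_revEdge hD hc hxb hyb]
    refine ih _ ?_ (isDAG_revEdge hD hc) ⟨fun a b => ?_, fun a b c => ?_, fun a b hab => ?_⟩ rfl
    · refine Finset.card_lt_card (Finset.ssubset_iff_of_subset ?_ |>.2 ⟨(x, y), ?_, ?_⟩)
      · rintro ⟨a, b⟩ hp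
        simp only [Finset.mem_filter, Finset.mem_univ, true_and] at hp ⊢
        rcases hp with ⟨h1 | ⟨rfl, rfl⟩, h2⟩
        · exact ⟨h1.1, h2⟩
        · exact absurd h2 (hD'.asymm hyx)
      · simpa using ⟨hxy, hyx⟩
      · simp only [Finset.mem_filter, Finset.mem_univ, true_and, not_and]
        rintro (h1 | ⟨rfl, -⟩)
        · exact absurd ⟨rfl, rfl⟩ h1.2
        · exact absurd hxy (hD.irrefl _)
    · rw [adjacent_revEdge_iff hxy, h.1]
    · rw [unshieldedCollider_revEdge_iff hD hc, h.2]
    · rw [← h.3 a b hab]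
      simp only [revEdge]
      grind
  · -- no edge is oriented differently, so the two graphs are equal
    push Not at hE
    have : D = D' := by
      ext a b
      constructor
      · exact fun hab => ((h.1 a b).1 (Or.inl hab)).resolve_right (hE a b hab)
      · exact fun hab => ((h.1 a b).2 (Or.inl hab)).resolve_right fun hba => hE b a hba hab
    rw [this]

/-- Parameters for `G₁` that have been rewritten as triangular parameters for a topological rank
of `G₂` are parameters for `G₂`, because such triangular parameters are unique. -/
lemma parameters_of_covModel_eq {G₁ G₂ : Digraph V} (h₁ : IsDAG G₁) {f : V → ℕ}
    (hf : ∀ a b, G₂.Adj a b → f a < f b) (h : covModel G₁ P = covModel G₂ P)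
    {L L' : Matrix V V ℝ} {w' : V → ℝ}
    (hL : ∀ a b, L a b ≠ 0 → G₁.Adj a b) (hL' : ∀ a b, L' a b ≠ 0 → f a < f b)
    (hp : prec L' w' = prec L 1) :
    (∀ a b, L' a b ≠ 0 → G₂.Adj a b) ∧ ∀ a b, SameBlock P a b → w' a = w' b := by
  obtain ⟨f₁, -, hf₁⟩ := exists_rank h₁
  have hmem : covParam L 1 ∈ covModel G₂ P := by
    rw [← h]
    exact ⟨L, 1, fun a b hab => not_not.1 (mt (hL a b) hab), fun _ => one_pos,
      fun _ _ _ => rfl, rfl⟩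
  obtain ⟨L₂, w₂, hL₂, hw₂, hb₂, he⟩ := hmem
  have hL₂' : ∀ a b, L₂ a b ≠ 0 → G₂.Adj a b := fun a b hab =>
    not_not.1 fun h' => hab (hL₂ a b h')
  have hp₂ := prec_eq_of_covParam_eq (fun a b hab => hf₁ _ _ (hL a b hab))
    (fun a b hab => hf _ _ (hL₂' a b hab)) (fun _ => one_pos) hw₂ he
  obtain ⟨rfl, rfl⟩ := prec_injective hL' (fun a b hab => hf _ _ (hL₂' a b hab)) hw₂
    (hp.trans hp₂)
  exact ⟨hL₂', hb₂⟩

/-- The test parameters are a single edge with weight one and unit variances. -/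
lemma adj_or_of_covModel_eq {G₁ G₂ : Digraph V} (h₁ : IsDAG G₁) (h₂ : IsDAG G₂)
    (h : covModel G₁ P = covModel G₂ P) {i j : V} (hij : G₁.Adj i j) :
    G₂.Adj i j ∨ (G₂.Adj j i ∧ i ∉ bigBlockNodes P ∧ j ∉ bigBlockNodes P) := by
  obtain ⟨f, hfi, hf⟩ := exists_rank h₂
  have hne := h₁.ne hij
  let L : Matrix V V ℝ := Matrix.of fun a b => if a = i ∧ b = j then 1 else 0
  have hLs : ∀ a b, L a b ≠ 0 → a = i ∧ b = j := by
    intro a b hab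
    by_contra h0
    exact hab (by simp only [L, of_apply, if_neg h0])
  have hLij : L i j = 1 := by simp [L]
  have hL : ∀ a b, L a b ≠ 0 → G₁.Adj a b := by
    intro a b hab; obtain ⟨rfl, rfl⟩ := hLs a b hab; exact hij
  have hpos : ∀ v : V, 0 < (1 : V → ℝ) v := fun _ => one_pos
  rcases lt_or_gt_of_ne (hfi.ne hne) with hlt | hgt
  · refine Or.inl ((parameters_of_covModel_eq h₁ hf h hL ?_ rfl).1 i j (by simp [hLij]))
    intro a b hab; obtain ⟨rfl, rfl⟩ := hLs a b hab; exact hlt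
  · have hii : L i i = 0 := by simp [L, hne]
    have hjj : L j j = 0 := by simp [L, hne.symm]
    have hji : L j i = 0 := by simp [L, hne]
    obtain ⟨h3, h4⟩ := parameters_of_covModel_eq (w' := revVar L 1 i j) h₁ hf h hL
      (L' := revCoeff L 1 i j) (fun a b hab => by
        rcases revCoeff_support hne hii hab with ⟨rfl, rfl⟩ | ⟨-, h5, h6⟩ | ⟨-, h5, h6⟩
        · exact hgt
        · exact absurd (hLs _ _ h6).2 h5
        · exact absurd (h6.elim (fun h => (hLs _ _ h).1) fun h => (hLs _ _ h).1) h5)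
      (prec_rev hpos hne)
    -- the error variances are `2` at `j`, `1 / 2` at `i` and `1` elsewhere
    have hwj : revVar L 1 i j j = 2 := by simp [revVar, hLij]; norm_num
    have hwi : revVar L 1 i j i = 1 / 2 := by simp [revVar, hLij, hne]; norm_num
    have hwv : ∀ v, v ≠ i → v ≠ j → revVar L 1 i j v = 1 := fun v h1 h2 => by
      simp [revVar, h1, h2]
    refine Or.inr ⟨h3 j i ?_, fun hb => ?_, fun hb => ?_⟩
    · rw [revCoeff_head hne hji hjj, hLij]; norm_num
    · obtain ⟨v, hv, hs⟩ := exists_sameBlock_ne hb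
      have h5 := h4 i v hs
      by_cases hvj : v = j
      · rw [hvj, hwi, hwj] at h5; norm_num at h5
      · rw [hwi, hwv v hv hvj] at h5; norm_num at h5
    · obtain ⟨v, hv, hs⟩ := exists_sameBlock_ne hb
      have h5 := h4 j v hs
      by_cases hvi : v = i
      · rw [hvi, hwi, hwj] at h5; norm_num at h5
      · rw [hwj, hwv v hvi hv] at h5; norm_num at h5

/-- If a collider `i → j ← k` of `G₁` with unit weights is rewritten for an order in which `i` is
the last of the three nodes, then the coefficient of `k` in the equation of `i` is `-1 / 2`. -/
lemma not_last_of_unshieldedCollider {G₁ G₂ : Digraph V} (h₁ : IsDAG G₁) (h₂ : IsDAG G₂)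
    (h : covModel G₁ P = covModel G₂ P) {f : V → ℕ} (hfi : Function.Injective f)
    (hf : ∀ a b, G₂.Adj a b → f a < f b) {i j k : V} (hc : UnshieldedCollider G₁ i j k)
    (hji : f j < f i) (hki : f k < f i) : False := by
  obtain ⟨hij, hkj, hik, hn⟩ := hc
  have hne := h₁.ne hij
  have hne' := h₁.ne hkj
  have hnk : ¬ G₂.Adj k i := fun hadj =>
    hn ((adj_or_of_covModel_eq h₂ h₁ h.symm hadj).elim Or.inr fun h => Or.inl h.1)
  let L : Matrix V V ℝ := Matrix.of fun a b => if (a = i ∨ a = k) ∧ b = j then 1 else 0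
  have hLs : ∀ a b, L a b ≠ 0 → (a = i ∨ a = k) ∧ b = j := by
    intro a b hab
    by_contra h0
    exact hab (by simp only [L, of_apply, if_neg h0])
  have hLij : L i j = 1 := by simp [L]
  have hLkj : L k j = 1 := by simp [L]
  have hii : L i i = 0 := by simp [L, hne]
  have hki0 : L k i = 0 := by simp [L, hne]
  have hL : ∀ a b, L a b ≠ 0 → G₁.Adj a b := by
    intro a b hab
    obtain ⟨rfl | rfl, rfl⟩ := hLs a b hab
    exacts [hij, hkj]
  have hpos : ∀ v : V, 0 < (1 : V → ℝ) v := fun _ => one_pos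
  have hcoef : revCoeff L 1 i j k i ≠ 0 := by
    rw [revCoeff_left hne hik.symm hne', hLij, hLkj, hki0]; norm_num
  have hsupp : ∀ a b, revCoeff L 1 i j a b ≠ 0 →
      (a = j ∧ b = i) ∨ (a = k ∧ (b = i ∨ b = j)) := by
    intro a b hab
    rcases revCoeff_support hne hii hab with h5 | ⟨-, h5, h6⟩ | ⟨h5, h6, h7⟩
    · exact Or.inl h5
    · exact absurd (hLs _ _ h6).2 h5
    · have : a = i ∨ a = k := h7.elim (fun h => (hLs _ _ h).1) fun h => (hLs _ _ h).1
      exact Or.inr ⟨this.resolve_left h6, h5⟩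
  rcases lt_or_gt_of_ne (hfi.ne hne') with hlt | hgt
  · refine hnk ((parameters_of_covModel_eq h₁ hf h hL (fun a b hab => ?_)
      (prec_rev hpos hne)).1 k i hcoef)
    rcases hsupp a b hab with ⟨rfl, rfl⟩ | ⟨rfl, rfl | rfl⟩
    exacts [hji, hki, hlt]
  · -- `k` comes after `j`: also exchange `j` and `k`, which leaves the equation of `i` unchanged
    have hkk : revCoeff L 1 i j k k = 0 := by
      by_contra h0
      rcases hsupp k k h0 with ⟨h5, -⟩ | ⟨-, h5 | h5⟩
      exacts [hne' h5, hik h5.symm, hne' h5]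
    refine hnk ((parameters_of_covModel_eq h₁ hf h hL (fun a b hab => ?_)
      ((prec_rev (i := k) (j := j) (revVar_pos hpos) hne').trans (prec_rev hpos hne))).1 k i ?_)
    · rcases revCoeff_support hne' hkk hab with ⟨rfl, rfl⟩ | ⟨h5, h6, h7⟩ | ⟨h5, h6, h7⟩
      · exact hgt
      · rcases hsupp a b h7 with ⟨rfl, rfl⟩ | ⟨rfl, rfl | rfl⟩
        exacts [hji, hki, absurd rfl h6]
      · rcases h7 with h7 | h7
        · rcases hsupp _ _ h7 with ⟨-, h8⟩ | ⟨h8, -⟩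
          exacts [absurd h8 hik.symm, absurd h8 h6]
        · rcases hsupp _ _ h7 with ⟨-, h8⟩ | ⟨h8, -⟩
          exacts [absurd h8 hne.symm, absurd h8 h6]
    · rwa [revCoeff_of_ne hne hik]

lemma UnshieldedCollider.symm {V : Type*} {G : Digraph V} {i j k : V}
    (h : UnshieldedCollider G i j k) : UnshieldedCollider G k j i :=
  ⟨h.2.1, h.1, h.2.2.1.symm, fun h' => h.2.2.2 h'.symm⟩

lemma unshieldedCollider_of_covModel_eq {G₁ G₂ : Digraph V} (h₁ : IsDAG G₁) (h₂ : IsDAG G₂)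
    (h : covModel G₁ P = covModel G₂ P) {i j k : V} (hc : UnshieldedCollider G₁ i j k) :
    UnshieldedCollider G₂ i j k := by
  obtain ⟨f, hfi, hf⟩ := exists_rank h₂
  have key : f i < f j ∧ f k < f j := by
    have h1 := not_last_of_unshieldedCollider h₁ h₂ h hfi hf hc
    have h2 := not_last_of_unshieldedCollider h₁ h₂ h hfi hf hc.symm
    have h3 := hfi.ne (h₁.ne hc.1)
    have h4 := hfi.ne (h₁.ne hc.2.1)
    have h5 := hfi.ne hc.2.2.1
    by_contra h0
    by_cases h6 : f j < f i
    · by_cases h7 : f k < f i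
      exacts [h1 h6 h7, h2 (by omega) (by omega)]
    · exact h2 (by omega) (by omega)
  refine ⟨?_, ?_, hc.2.2.1, fun hadj => hc.2.2.2 ?_⟩
  · exact (adj_or_of_covModel_eq h₁ h₂ h hc.1).resolve_right fun h' =>
      absurd (hf _ _ h'.1) (by omega)
  · exact (adj_or_of_covModel_eq h₁ h₂ h hc.2.1).resolve_right fun h' =>
      absurd (hf _ _ h'.1) (by omega)
  · rcases hadj with h' | h'
    · exact (adj_or_of_covModel_eq h₂ h₁ h.symm h').imp id fun h => h.1
    · exact ((adj_or_of_covModel_eq h₂ h₁ h.symm h').imp id fun h => h.1).symm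

/-- The graphical characterization of model equivalence for DAGs. -/
theorem modelEquiv_iff {G₁ G₂ : Digraph V} (h₁ : IsDAG G₁) (h₂ : IsDAG G₂) :
    ModelEquiv P G₁ G₂ ↔ GraphEquiv P G₁ G₂ := by
  refine ⟨fun h => ?_, covModel_eq_of_graphEquiv h₁ h₂⟩
  have h' : covModel G₁ P = covModel G₂ P := h
  have key : ∀ {G₁ G₂ : Digraph V}, IsDAG G₁ → IsDAG G₂ → covModel G₁ P = covModel G₂ P →
      ∀ a b, Adjacent G₁ a b → Adjacent G₂ a b := by
    intro G₁ G₂ h₁ h₂ h a b hab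
    rcases hab with hab | hab
    · exact (adj_or_of_covModel_eq h₁ h₂ h hab).imp id fun h => h.1
    · exact ((adj_or_of_covModel_eq h₁ h₂ h hab).imp id fun h => h.1).symm
  have key' : ∀ {G₁ G₂ : Digraph V}, IsDAG G₁ → IsDAG G₂ → covModel G₁ P = covModel G₂ P →
      ∀ a b, a ∈ bigBlockNodes P ∨ b ∈ bigBlockNodes P → G₁.Adj a b → G₂.Adj a b := by
    intro G₁ G₂ h₁ h₂ h a b hb hab
    exact (adj_or_of_covModel_eq h₁ h₂ h hab).resolve_right fun h0 =>
      hb.elim h0.2.1 h0.2.2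
  exact ⟨fun a b => ⟨key h₁ h₂ h' a b, key h₂ h₁ h'.symm a b⟩,
    fun a b c => ⟨unshieldedCollider_of_covModel_eq h₁ h₂ h',
      unshieldedCollider_of_covModel_eq h₂ h₁ h'.symm⟩,
    fun a b hb => ⟨key' h₁ h₂ h' a b hb, key' h₂ h₁ h'.symm a b hb⟩⟩

end ModelEquivalence

/-! ### Perfect orders of chordal graphs -/

section Chordal

variable {V : Type*} {U : V → V → Prop}

/-- The rank `f` orders the nodes of `A` perfectly with respect to the undirected graph `U`: any
two neighbours that precede a node are adjacent. A graph with such an order is chordal. -/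
def PerfectOn (U : V → V → Prop) (f : V → ℕ) (A : Finset V) : Prop :=
  ∀ a ∈ A, ∀ b ∈ A, ∀ c ∈ A, a ≠ b → U a c → U b c → f a < f c → f b < f c → U a b

/-- The neighbours of `u` within `A` form a clique. -/
def Simplicial (U : V → V → Prop) (A : Finset V) (u : V) : Prop :=
  ∀ a ∈ A, ∀ b ∈ A, a ≠ b → U a u → U b u → U a b

lemma PerfectOn.mono {f : V → ℕ} {A B : Finset V} (h : PerfectOn U f B) (hAB : A ⊆ B) :
    PerfectOn U f A :=
  fun a ha b hb c hc => h a (hAB ha) b (hAB hb) c (hAB hc)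

/-- Dirac's theorem for graphs given with a perfect order: a graph that is not complete has two
nonadjacent simplicial nodes. -/
lemma complete_or_exists_simplicial [DecidableEq V] (hU : ∀ a b, U a b → U b a) {f : V → ℕ}
    (hf : Function.Injective f) (A : Finset V) (hA : PerfectOn U f A) :
    (∀ a ∈ A, ∀ b ∈ A, a ≠ b → U a b) ∨
      ∃ u ∈ A, ∃ v ∈ A, u ≠ v ∧ Simplicial U A u ∧ Simplicial U A v ∧ ¬ U u v := by
  induction A using Finset.induction_on_max_value f with
  | empty => simp
  | insert z s hz hmax ih =>
    have hlt : ∀ x ∈ s, f x < f z := fun x hx =>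
      lt_of_le_of_ne (hmax x hx) (hf.ne (by rintro rfl; exact hz hx))
    have hpast : ∀ a ∈ s, ∀ b ∈ s, a ≠ b → U a z → U b z → U a b := fun a ha b hb hab h1 h2 =>
      hA a (Finset.mem_insert_of_mem ha) b (Finset.mem_insert_of_mem hb) z
        (Finset.mem_insert_self z s) hab h1 h2 (hlt a ha) (hlt b hb)
    have hzs : Simplicial U (insert z s) z := by
      intro a ha b hb hab h1 h2
      rcases Finset.mem_insert.1 ha with rfl | ha
      · exact hU _ _ h2
      rcases Finset.mem_insert.1 hb with rfl | hb
      · exact h1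
      exact hpast a ha b hb hab h1 h2
    -- a simplicial node of `s` that is not adjacent to `z` forms the wanted pair with `z`
    have hpair : ∀ x ∈ s, Simplicial U s x → ¬ U x z →
        ∃ u ∈ insert z s, ∃ v ∈ insert z s,
          u ≠ v ∧ Simplicial U (insert z s) u ∧ Simplicial U (insert z s) v ∧ ¬ U u v := by
      intro x hx hsx hxz
      refine ⟨x, Finset.mem_insert_of_mem hx, z, Finset.mem_insert_self z s,
        by rintro rfl; exact hz hx, ?_, hzs, hxz⟩
      have hmem : ∀ a ∈ insert z s, U a x → a ∈ s := by
        intro a ha hax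
        rcases Finset.mem_insert.1 ha with rfl | ha
        · exact absurd (hU _ _ hax) hxz
        · exact ha
      exact fun a ha b hb hab h1 h2 => hsx a (hmem a ha h1) b (hmem b hb h2) hab h1 h2
    rcases ih (hA.mono (Finset.subset_insert z s)) with hc | ⟨u, hu, v, hv, huv, hsu, hsv, hn⟩
    · by_cases hall : ∀ x ∈ s, U x z
      · left
        intro a ha b hb hab
        rcases Finset.mem_insert.1 ha with rfl | ha'
        · rcases Finset.mem_insert.1 hb with rfl | hb'
          · exact absurd rfl hab
          · exact hU _ _ (hall b hb')
        · rcases Finset.mem_insert.1 hb with rfl | hb'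
          · exact hall a ha'
          · exact hc a ha' b hb' hab
      · push Not at hall
        obtain ⟨x, hx, hxz⟩ := hall
        exact Or.inr (hpair x hx (fun a ha b hb hab _ _ => hc a ha b hb hab) hxz)
    · right
      by_cases huz : U u z
      · exact hpair v hv hsv fun hvz => hn (hpast u hu v hv huv huz hvz)
      · exact hpair u hu hsu huz

/-- In a chordal graph every node is the first node of some perfect order: repeatedly put a
simplicial node other than `r` at the end. -/
lemma exists_perfectOn_first [DecidableEq V] (hU : ∀ a b, U a b → U b a) {f : V → ℕ}
    (hf : Function.Injective f) {r : V} (A : Finset V) (hr : r ∈ A) (hA : PerfectOn U f A) :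
    ∃ g : V → ℕ, Set.InjOn g A ∧ PerfectOn U g A ∧ ∀ v ∈ A, v ≠ r → g r < g v := by
  induction A using Finset.strongInduction with
  | H A ih =>
  by_cases hone : ∀ v ∈ A, v = r
  · refine ⟨f, hf.injOn, hA, fun v hv hvr => absurd (hone v hv) hvr⟩
  obtain ⟨u, hu, hur, hsu⟩ : ∃ u ∈ A, u ≠ r ∧ Simplicial U A u := by
    rcases complete_or_exists_simplicial hU hf A hA with hc | ⟨u, hu, v, hv, huv, hsu, hsv, -⟩
    · push Not at hone
      obtain ⟨u, hu, hur⟩ := hone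
      exact ⟨u, hu, hur, fun a ha b hb hab _ _ => hc a ha b hb hab⟩
    · by_cases hur : u = r
      · exact ⟨v, hv, fun h => huv (hur.trans h.symm), hsv⟩
      · exact ⟨u, hu, hur, hsu⟩
  obtain ⟨g, hg, hgp, hgr⟩ := ih (A.erase u) (Finset.erase_ssubset hu)
    (Finset.mem_erase.2 ⟨hur.symm, hr⟩) (hA.mono (Finset.erase_subset u A))
  let g' : V → ℕ := fun v => if v = u then A.sup g + 1 else g v
  have hgu : g' u = A.sup g + 1 := if_pos rfl
  have hgv : ∀ v, v ≠ u → g' v = g v := fun v hv => if_neg hv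
  have hlt : ∀ v ∈ A, v ≠ u → g' v < g' u := fun v hv hvu => by
    rw [hgu, hgv v hvu]; exact Nat.lt_succ_of_le (Finset.le_sup hv)
  refine ⟨g', ?_, ?_, ?_⟩
  · intro a ha b hb hab
    by_cases hau : a = u
    · by_contra hne
      subst hau
      exact absurd hab (hlt b hb (Ne.symm hne)).ne'
    by_cases hbu : b = u
    · subst hbu
      exact absurd hab (hlt a ha hau).ne
    rw [hgv a hau, hgv b hbu] at hab
    exact hg (by simpa using ⟨ha, hau⟩) (by simpa using ⟨hb, hbu⟩) hab
  · intro a ha b hb c hc hab h1 h2 h3 h4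
    by_cases hcu : c = u
    · exact hsu a ha b hb hab (hcu ▸ h1) (hcu ▸ h2)
    have hne : ∀ x, g' x < g' c → x ≠ u := by
      rintro x hx rfl
      exact absurd (hlt c hc hcu) hx.not_gt
    have hau := hne a h3
    have hbu := hne b h4
    rw [hgv a hau, hgv c hcu] at h3
    rw [hgv b hbu, hgv c hcu] at h4
    exact hgp a (Finset.mem_erase.2 ⟨hau, ha⟩) b (Finset.mem_erase.2 ⟨hbu, hb⟩) c
      (Finset.mem_erase.2 ⟨hcu, hc⟩) hab h1 h2 h3 h4
  · intro v hv hvr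
    by_cases hvu : v = u
    · subst hvu; exact hlt r hr hur.symm
    · rw [hgv r hur.symm, hgv v hvu]
      exact hgr v (Finset.mem_erase.2 ⟨hvu, hv⟩) hvr

end Chordal

/-! ### Mixed graphs with the chain property -/

section Mixed

variable {V : Type*}

lemma Adjacent.trichotomy {H : Digraph V} {a b : V} (h : Adjacent H a b) :
    DirEdge H a b ∨ DirEdge H b a ∨ UndirEdge H a b := by
  unfold Adjacent DirEdge UndirEdge at *
  tauto

lemma UndirEdge.symm {H : Digraph V} {a b : V} (h : UndirEdge H a b) : UndirEdge H b a :=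
  ⟨h.2, h.1⟩

lemma UndirEdge.not_dirEdge {H : Digraph V} {a b : V} (h : UndirEdge H a b) :
    ¬ DirEdge H a b :=
  fun h' => h'.2 h.2

/-- A directed edge into a node is inherited by every node joined to it by an undirected edge;
this is the defining property of a chain graph whose chain components have constant outside
parents. -/
def ChainProperty (H : Digraph V) : Prop :=
  ∀ a b c, DirEdge H a b → UndirEdge H b c → DirEdge H a c

/-- Neither R1 nor R2 applies to the mixed graph. -/
def ClosedR12 (H : Digraph V) : Prop :=
  ∀ i j, ¬ RuleR1 H i j ∧ ¬ RuleR2 H i j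

variable {H : Digraph V}

lemma ClosedR12.adjacent (hH : ClosedR12 H) {a b c : V} (h : DirEdge H a b)
    (h' : UndirEdge H b c) : Adjacent H a c :=
  not_not.1 fun hn => (hH b c).1 ⟨h', a, h, hn⟩

lemma ClosedR12.not_undirEdge (hH : ClosedR12 H) {a b c : V} (h : DirEdge H a b)
    (h' : DirEdge H b c) : ¬ UndirEdge H a c :=
  fun hn => (hH a c).2 ⟨hn, b, h, h'⟩

/-- Under R1 and R2 only a triangle `a → b - c - a` can violate the chain property. -/
lemma ClosedR12.chainProperty (hH : ClosedR12 H)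
    (h : ∀ a b c, DirEdge H a b → UndirEdge H b c → ¬ UndirEdge H a c) : ChainProperty H := by
  intro a b c hab hbc
  rcases (hH.adjacent hab hbc).trichotomy with h1 | h1 | h1
  · exact h1
  · exact absurd hbc.symm (hH.not_undirEdge h1 hab)
  · exact absurd h1 (h a b c hab hbc)

/-- If `a → b` was oriented by R1 because of `d → a`, then a triangle `a → b - c - a` yields the
triangle `d → a - c - d`. -/
lemma ClosedR12.undirEdge_of_R1 (hH : ClosedR12 H) {a b c d : V} (hda : DirEdge H d a)
    (hdb : ¬ Adjacent H d b) (hbc : UndirEdge H b c) (hac : UndirEdge H a c) :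
    UndirEdge H d c := by
  rcases (hH.adjacent hda hac).trichotomy with h | h | h
  · exact absurd (hH.adjacent h hbc.symm) hdb
  · exact absurd hac.symm (hH.not_undirEdge h hda)
  · exact h

/-- If `a → b` was oriented by R2 because of `a → d → b`, then a triangle `a → b - c - a` yields
the triangle `a → d - c - a`. -/
lemma ClosedR12.undirEdge_of_R2 (hH : ClosedR12 H) {a b c d : V} (had : DirEdge H a d)
    (hdb : DirEdge H d b) (hbc : UndirEdge H b c) (hac : UndirEdge H a c) :
    UndirEdge H d c := by
  rcases (hH.adjacent hdb hbc).trichotomy with h | h | h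
  · exact absurd hac (hH.not_undirEdge had h)
  · exact absurd hbc.symm (hH.not_undirEdge h hdb)
  · exact h

end Mixed

section Extension

variable {V : Type*} [Fintype V] [DecidableEq V] {P : Finpartition (Finset.univ : Finset V)}

/-- The mixed graph `H` has the skeleton of `G`, all its directed edges occur in every DAG that
is equivalent to `G`, and it directs all edges in unshielded colliders of `G`. -/
structure Sound (P : Finpartition (Finset.univ : Finset V)) (G H : Digraph V) : Prop where
  adjacent_iff : ∀ a b, Adjacent H a b ↔ Adjacent G a b
  adj_of_dirEdge : ∀ D, IsDAG D → GraphEquiv P D G → ∀ a b, DirEdge H a b → D.Adj a b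
  collider : ∀ a b c, UnshieldedCollider G a b c → DirEdge H a b

lemma GraphEquiv.refl (G : Digraph V) : GraphEquiv P G G :=
  ⟨fun _ _ => Iff.rfl, fun _ _ _ => Iff.rfl, fun _ _ _ => Iff.rfl⟩

variable {G H : Digraph V}

lemma Sound.adj (hs : Sound P G H) (hG : IsDAG G) {a b : V} (h : DirEdge H a b) : G.Adj a b :=
  hs.adj_of_dirEdge G hG (.refl G) a b h

/-- Undirected edges of a sound mixed graph with the chain property can be oriented along any
perfect order of the undirected part without creating directed cycles or new unshielded
colliders. Starting the order at `a` gives the orientation `a → b` of the edge `a - b`. -/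
lemma exists_isDAG_adj_of_undirEdge (hG : IsDAG G) (hs : Sound P G H) (hch : ChainProperty H)
    (hbig : ∀ a ∈ bigBlockNodes P, ∀ b, ¬ UndirEdge H a b) {a b : V} (hab : UndirEdge H a b) :
    ∃ D, IsDAG D ∧ GraphEquiv P D G ∧ D.Adj a b := by
  obtain ⟨f, hfi, hf⟩ := exists_rank hG
  have hlt : ∀ x y, UndirEdge H x y → f x < f y → G.Adj x y := fun x y hxy hl =>
    ((hs.adjacent_iff x y).1 (Or.inl hxy.1)).resolve_right fun h => absurd (hf _ _ h) hl.not_gt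
  have hundir : ∀ x y z, Adjacent H x y → UndirEdge H x z → UndirEdge H y z →
      UndirEdge H x y := by
    intro x y z hxy hxz hyz
    rcases hxy.trichotomy with h | h | h
    · exact absurd (hch _ _ _ h hyz) hxz.not_dirEdge
    · exact absurd (hch _ _ _ h hxz) hyz.not_dirEdge
    · exact h
  have hperf : PerfectOn (UndirEdge H) f Finset.univ := by
    intro x _ y _ z _ hxy hxz hyz h1 h2
    refine hundir x y z ?_ hxz hyz
    rw [hs.adjacent_iff]
    by_contra hn
    exact hxz.not_dirEdge (hs.collider x z y ⟨hlt _ _ hxz h1, hlt _ _ hyz h2, hxy, hn⟩)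
  obtain ⟨g, hgi, hgp, hga⟩ := exists_perfectOn_first (fun _ _ h => h.symm) hfi Finset.univ
    (Finset.mem_univ a) hperf
  let Ug : V → V → Prop := fun x y => UndirEdge H x y ∧ g x < g y
  let D : Digraph V := ⟨fun x y => DirEdge H x y ∨ Ug x y⟩
  have hne : ∀ x y, UndirEdge H x y → x ≠ y := by
    rintro x y hxy rfl
    exact ((hs.adjacent_iff x x).1 (Or.inl hxy.1)).elim (hG.irrefl x) (hG.irrefl x)
  have hgne : ∀ x y, UndirEdge H x y → g x ≠ g y := fun x y hxy h =>
    hne x y hxy (hgi (Finset.mem_coe.2 (Finset.mem_univ x))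
      (Finset.mem_coe.2 (Finset.mem_univ y)) h)
  -- a path that ends with a directed edge followed by undirected edges can be shortened
  have habsorb : ∀ {x y z}, TransGen (DirEdge H) x y → ReflTransGen Ug y z →
      TransGen (DirEdge H) x z := by
    intro x y z h1 h2
    induction h2 with
    | refl => exact h1
    | tail _ h ih =>
      obtain ⟨u, hu, hu'⟩ := TransGen.tail'_iff.1 ih
      exact TransGen.tail' hu (hch _ _ _ hu' h.1)
  have hpath : ∀ {x y}, TransGen D.Adj x y →
      TransGen Ug x y ∨ ∃ z, ReflTransGen Ug x z ∧ TransGen (DirEdge H) z y := by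
    intro x y h
    induction h with
    | single h =>
      rcases h with h | h
      · exact Or.inr ⟨x, .refl, .single h⟩
      · exact Or.inl (.single h)
    | tail _ h ih =>
      rcases h with h | h <;> rcases ih with ih | ⟨z, h1, h2⟩
      · exact Or.inr ⟨_, ih.to_reflTransGen, .single h⟩
      · exact Or.inr ⟨z, h1, h2.tail h⟩
      · exact Or.inl (ih.tail h)
      · exact Or.inr ⟨z, h1, habsorb h2 (.single h)⟩
  have hD : IsDAG D := by
    intro v hv
    rcases hpath hv with h | ⟨z, h1, h2⟩
    · have hmono : ∀ {x y}, TransGen Ug x y → g x < g y := by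
        intro x y h
        induction h with
        | single h => exact h.2
        | tail _ h ih => exact ih.trans h.2
      exact lt_irrefl _ (hmono h)
    · exact hG z (TransGen.mono (fun _ _ h => hs.adj hG h) _ _ (habsorb h2 h1))
  have hadj : ∀ x y, Adjacent D x y ↔ Adjacent G x y := by
    intro x y
    rw [← hs.adjacent_iff]
    constructor
    · rintro ((h | h) | (h | h))
      exacts [Or.inl h.1, Or.inl h.1.1, Or.inr h.1, Or.inr h.1.1]
    · intro h
      rcases h.trichotomy with h | h | h
      · exact Or.inl (Or.inl h)
      · exact Or.inr (Or.inl h)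
      · rcases lt_or_gt_of_ne (hgne x y h) with h' | h'
        · exact Or.inl (Or.inr ⟨h, h'⟩)
        · exact Or.inr (Or.inr ⟨h.symm, h'⟩)
  have hDG : ∀ x y, DirEdge H x y ↔ G.Adj x y ∧ ¬ UndirEdge H x y := by
    intro x y
    refine ⟨fun h => ⟨hs.adj hG h, fun h' => h'.not_dirEdge h⟩, fun ⟨h, h'⟩ => ?_⟩
    rcases ((hs.adjacent_iff x y).2 (Or.inl h)).trichotomy with h1 | h1 | h1
    · exact h1
    · exact absurd (hs.adj hG h1) (hG.asymm h)
    · exact absurd h1 h'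
  refine ⟨D, hD, ⟨hadj, fun x y z => ⟨?_, ?_⟩, fun x y hxy => ?_⟩,
    Or.inr ⟨hab, hga b (Finset.mem_univ b) (hne a b hab).symm⟩⟩
  · rintro ⟨h1, h2, h3, h4⟩
    have h4' : ¬ Adjacent H x z := by rwa [hs.adjacent_iff, ← hadj]
    rcases h1 with h1 | h1 <;> rcases h2 with h2 | h2
    · exact ⟨hs.adj hG h1, hs.adj hG h2, h3, by rwa [← hadj]⟩
    · exact absurd (Or.inl (hch _ _ _ h1 h2.1.symm).1) h4'
    · exact absurd (Or.inr (hch _ _ _ h2 h1.1.symm).1) h4'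
    · exact absurd (Or.inl (hgp x (Finset.mem_univ x) z (Finset.mem_univ z) y (Finset.mem_univ y)
        h3 h1.1 h2.1 h1.2 h2.2).1) h4'
  · intro h
    exact ⟨Or.inl (hs.collider _ _ _ h), Or.inl (hs.collider _ _ _ h.symm), h.2.2.1,
      by rw [hadj]; exact h.2.2.2⟩
  · have hn : ¬ UndirEdge H x y := hxy.elim (fun h => hbig x h y) fun h h' => hbig y h x h'.symm
    show DirEdge H x y ∨ Ug x y ↔ _
    rw [hDG]
    exact ⟨fun h => h.elim (fun h => h.1) fun h => absurd h.1 hn, fun h => Or.inl ⟨h, hn⟩⟩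

/-- A sound mixed graph with the chain property and without undirected edges at nodes in large
blocks is the CPDAG. -/
lemma Sound.eq_cpdag (hG : IsDAG G) (hs : Sound P G H) (hch : ChainProperty H)
    (hbig : ∀ a ∈ bigBlockNodes P, ∀ b, ¬ UndirEdge H a b) : H = cpdag G P := by
  ext a b
  constructor
  · intro h
    by_cases h' : H.Adj b a
    · obtain ⟨D, hD, hDG, hDab⟩ := exists_isDAG_adj_of_undirEdge hG hs hch hbig ⟨h, h'⟩
      exact ⟨D, ⟨hD, (modelEquiv_iff hD hG).2 hDG⟩, hDab⟩
    · exact ⟨G, ⟨hG, rfl⟩, hs.adj hG ⟨h, h'⟩⟩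
  · rintro ⟨D, ⟨hD, hDG⟩, hDab⟩
    have hDG' := (modelEquiv_iff hD hG).1 hDG
    by_contra hn
    have : H.Adj b a := ((hs.adjacent_iff a b).2 ((hDG'.adjacent_iff a b).1
      (Or.inl hDab))).resolve_left hn
    exact hD.asymm hDab (hs.adj_of_dirEdge D hD hDG' b a ⟨this, hn⟩)

end Extension

/-! ### Applications of the orientation rules -/

section Rules

variable {V : Type*} {H : Digraph V} {i j : V}

lemma dirEdge_orient_iff (h : UndirEdge H i j) (hij : i ≠ j) (a b : V) :
    DirEdge (orient H i j) a b ↔ DirEdge H a b ∨ (a = i ∧ b = j) := by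
  have := h.1
  have := h.2
  simp only [DirEdge, orient]
  grind

lemma adjacent_orient_iff (h : UndirEdge H i j) (hij : i ≠ j) (a b : V) :
    Adjacent (orient H i j) a b ↔ Adjacent H a b := by
  have := h.1
  have := h.2
  simp only [Adjacent, orient]
  grind

lemma UndirEdge.of_orient {a b : V} (h : UndirEdge (orient H i j) a b) : UndirEdge H a b :=
  ⟨h.1.1, h.2.1⟩

/-- `a → b` is justified by R1. -/
def ReasonR1 (H : Digraph V) (a b : V) : Prop := ∃ d, DirEdge H d a ∧ ¬ Adjacent H d b

/-- `a → b` is justified by R2. -/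
def ReasonR2 (H : Digraph V) (a b : V) : Prop := ∃ d, DirEdge H a d ∧ DirEdge H d b

/-- `a → b` is justified by R3. As the edges `a - d` and `a - e` may have been oriented later,
only what remains true of them is recorded: they do not form a collider in `G`. -/
def ReasonR3 (G H : Digraph V) (a b : V) : Prop :=
  ∃ d e, d ≠ e ∧ ¬ Adjacent H d e ∧ Adjacent H a d ∧ Adjacent H a e ∧ DirEdge H d b ∧
    DirEdge H e b ∧ ¬ (G.Adj d a ∧ G.Adj e a)

variable {G H' : Digraph V} {a b : V}

lemma ReasonR1.mono (hd : ∀ a b, DirEdge H a b → DirEdge H' a b)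
    (ha : ∀ a b, Adjacent H' a b ↔ Adjacent H a b) (h : ReasonR1 H a b) : ReasonR1 H' a b :=
  let ⟨d, h1, h2⟩ := h; ⟨d, hd _ _ h1, by rwa [ha]⟩

lemma ReasonR2.mono (hd : ∀ a b, DirEdge H a b → DirEdge H' a b)
    (h : ReasonR2 H a b) : ReasonR2 H' a b :=
  let ⟨d, h1, h2⟩ := h; ⟨d, hd _ _ h1, hd _ _ h2⟩

lemma ReasonR3.mono (hd : ∀ a b, DirEdge H a b → DirEdge H' a b)
    (ha : ∀ a b, Adjacent H' a b ↔ Adjacent H a b) (h : ReasonR3 G H a b) : ReasonR3 G H' a b :=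
  let ⟨d, e, h1, h2, h3, h4, h5, h6, h7⟩ := h
  ⟨d, e, h1, by rwa [ha], by rwa [ha], by rwa [ha], hd _ _ h5, hd _ _ h6, h7⟩

lemma adjacent_patternGraph_iff (a b : V) :
    Adjacent (patternGraph G) a b ↔ Adjacent G a b := by
  simp only [Adjacent, patternGraph]
  tauto

lemma dirEdge_patternGraph_iff (hG : IsDAG G) (a b : V) :
    DirEdge (patternGraph G) a b ↔ ∃ d, UnshieldedCollider G a b d := by
  constructor
  · rintro ⟨h1 | h1, h2⟩
    · by_contra hn
      exact h2 (Or.inr ⟨h1, hn⟩)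
    · exact absurd (Or.inl h1.1) h2
  · rintro ⟨d, hd⟩
    refine ⟨Or.inl hd.1, ?_⟩
    rintro (h | h)
    · exact hG.asymm hd.1 h
    · exact h.2 ⟨d, hd⟩

lemma closedR12_of_not_step (h : ∀ H', ¬ StepR12 H H') : ClosedR12 H := fun i j =>
  ⟨fun hr => h _ ⟨i, j, Or.inl hr, rfl⟩, fun hr => h _ ⟨i, j, Or.inr hr, rfl⟩⟩

end Rules

section Phases

variable {V : Type*} [Fintype V] [DecidableEq V] {P : Finpartition (Finset.univ : Finset V)}
  {G H : Digraph V} {i j : V}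

lemma Sound.ne (hs : Sound P G H) (hG : IsDAG G) {a b : V} (h : UndirEdge H a b) : a ≠ b := by
  rintro rfl
  exact ((hs.adjacent_iff a a).1 (Or.inl h.1)).elim (hG.irrefl a) (hG.irrefl a)

/-- Each rule orients an edge in the only way that avoids a directed cycle or a new unshielded
collider, so its conclusion holds in every equivalent DAG. -/
lemma Sound.orient_of_rule (hG : IsDAG G) (hs : Sound P G H)
    (h : RuleR1 H i j ∨ RuleR2 H i j ∨ RuleR3 H i j) : Sound P G (orient H i j) := by
  have hu : UndirEdge H i j := by
    rcases h with h | h | h <;> exact h.1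
  have hij := hs.ne hG hu
  refine ⟨fun a b => by rw [adjacent_orient_iff hu hij, hs.adjacent_iff],
    fun D hD hDG a b hab => ?_,
    fun a b c hc => (dirEdge_orient_iff hu hij a b).2 (Or.inl (hs.collider a b c hc))⟩
  have hdir := hs.adj_of_dirEdge D hD hDG
  have hadj : ∀ a b, Adjacent D a b ↔ Adjacent H a b := fun a b => by
    rw [hDG.adjacent_iff, hs.adjacent_iff]
  rcases (dirEdge_orient_iff hu hij a b).1 hab with hab | ⟨rfl, rfl⟩
  · exact hdir a b hab
  refine ((hadj a b).2 (Or.inl hu.1)).resolve_right fun hba => ?_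
  rcases h with ⟨-, d, hda, hn⟩ | ⟨-, d, had, hdb⟩ | ⟨-, d, e, hne, hn, had, hae, hdb, heb⟩
  · have hc : UnshieldedCollider D b a d :=
      ⟨hba, hdir _ _ hda, by rintro rfl; exact hu.symm.not_dirEdge hda,
        fun h' => hn ((hadj d b).1 h'.symm)⟩
    exact hu.symm.not_dirEdge (hs.collider b a d ((hDG.collider_iff b a d).1 hc))
  · exact hD.no_triangle (hdir _ _ had) (hdir _ _ hdb) hba
  · have key : ∀ x, UndirEdge H a x → DirEdge H x b → D.Adj x a := fun x hax hxb =>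
      ((hadj a x).2 (Or.inl hax.1)).resolve_left fun h' => hD.no_triangle h' (hdir _ _ hxb) hba
    have hc : UnshieldedCollider D d a e :=
      ⟨key d had hdb, key e hae heb, hne, by rwa [hadj]⟩
    exact had.symm.not_dirEdge (hs.collider d a e ((hDG.collider_iff d a e).1 hc))

/-- The invariant of the first phase: every directed edge belongs to an unshielded collider or
is justified by one of the rules R1, R2, R3. -/
structure PatternPhase (P : Finpartition (Finset.univ : Finset V)) (G H : Digraph V) : Prop where
  sound : Sound P G H
  reason : ∀ a b, DirEdge H a b → (∃ d, UnshieldedCollider G a b d) ∨ ReasonR1 H a b ∨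
    ReasonR2 H a b ∨ ReasonR3 G H a b

lemma patternPhase_patternGraph (hG : IsDAG G) : PatternPhase P G (patternGraph G) := by
  refine ⟨⟨adjacent_patternGraph_iff, fun D hD hDG a b hab => ?_,
    fun a b c hc => (dirEdge_patternGraph_iff hG a b).2 ⟨c, hc⟩⟩,
    fun a b hab => Or.inl ((dirEdge_patternGraph_iff hG a b).1 hab)⟩
  obtain ⟨d, hd⟩ := (dirEdge_patternGraph_iff hG a b).1 hab
  exact ((hDG.collider_iff a b d).2 hd).1

lemma PatternPhase.step (hG : IsDAG G) {H' : Digraph V} (h : PatternPhase P G H)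
    (hstep : StepR123 H H') : PatternPhase P G H' := by
  obtain ⟨i, j, hr, rfl⟩ := hstep
  have hu : UndirEdge H i j := by
    rcases hr with h | h | h <;> exact h.1
  have hij := h.sound.ne hG hu
  have hd : ∀ a b, DirEdge H a b → DirEdge (orient H i j) a b := fun a b h =>
    (dirEdge_orient_iff hu hij a b).2 (Or.inl h)
  have ha := adjacent_orient_iff hu hij
  refine ⟨h.sound.orient_of_rule hG hr, fun a b hab => ?_⟩
  rcases (dirEdge_orient_iff hu hij a b).1 hab with hab | ⟨rfl, rfl⟩
  · exact (h.reason a b hab).imp id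
      (Or.imp (ReasonR1.mono hd ha) (Or.imp (ReasonR2.mono hd) (ReasonR3.mono hd ha)))
  · rcases hr with ⟨-, hr⟩ | ⟨-, hr⟩ | ⟨-, d, e, hne, hn, had, hae, hdb, heb⟩
    · exact Or.inr (Or.inl (ReasonR1.mono hd ha hr))
    · exact Or.inr (Or.inr (Or.inl (ReasonR2.mono hd hr)))
    · refine Or.inr (Or.inr (Or.inr (ReasonR3.mono hd ha
        ⟨d, e, hne, hn, Or.inl had.1, Or.inl hae.1, hdb, heb, fun hc => ?_⟩)))
      refine had.symm.not_dirEdge (h.sound.collider d a e ⟨hc.1, hc.2, hne, ?_⟩)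
      rwa [← h.sound.adjacent_iff]

/-- When the first phase ends, the chain property holds. A triangle `a → b - c - a` whose head
`b` comes first in a topological order of `G` is excluded by inspecting why `a → b` is directed:
if it is part of a collider, some rule applies, and each rule as a reason gives an earlier triangle
or again an applicable rule. -/
lemma PatternPhase.chainProperty (hG : IsDAG G) (h : PatternPhase P G H)
    (hend : ∀ H', ¬ StepR123 H H') : ChainProperty H := by
  have hcl : ClosedR12 H := fun i j =>
    ⟨fun hr => hend _ ⟨i, j, Or.inl hr, rfl⟩, fun hr => hend _ ⟨i, j, Or.inr (Or.inl hr), rfl⟩⟩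
  have hR3 : ∀ i j, ¬ RuleR3 H i j := fun i j hr => hend _ ⟨i, j, Or.inr (Or.inr hr), rfl⟩
  have hs := h.sound
  obtain ⟨f, -, hf⟩ := exists_rank hG
  have hcollider : ∀ a b c d, UnshieldedCollider G a b d → UndirEdge H b c →
      ¬ UndirEdge H a c := by
    intro a b c d hc hbc hac
    have hab := hs.collider _ _ _ hc
    have hdb := hs.collider _ _ _ hc.symm
    have hn : ¬ Adjacent H a d := by rw [hs.adjacent_iff]; exact hc.2.2.2
    rcases (hcl.adjacent hdb hbc).trichotomy with h1 | h1 | h1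
    · exact hn (hcl.adjacent h1 hac.symm).symm
    · exact hcl.not_undirEdge h1 hdb hbc.symm
    · exact hR3 c b ⟨hbc.symm, a, d, hc.2.2.1, hn, hac.symm, h1.symm, hab, hdb⟩
  refine hcl.chainProperty fun a b c => ?_
  induction hn : f b using Nat.strong_induction_on generalizing a b with
  | _ n ih =>
  subst hn
  intro hab hbc hac
  rcases h.reason a b hab with ⟨d, hc⟩ | ⟨d, hda, hdb⟩ | ⟨d, had, hdb⟩ |
    ⟨d, e, hne, hde, had, hae, hdb, heb, hcol⟩
  · exact hcollider a b c d hc hbc hac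
  · exact ih (f a) (hf _ _ (hs.adj hG hab)) d a rfl hda hac
      (hcl.undirEdge_of_R1 hda hdb hbc hac)
  · exact ih (f d) (hf _ _ (hs.adj hG hdb)) a d rfl had
      (hcl.undirEdge_of_R2 had hdb hbc hac) hac
  · have hde' : ¬ Adjacent G d e := by rwa [← hs.adjacent_iff]
    have hc : UnshieldedCollider G d b e := ⟨hs.adj hG hdb, hs.adj hG heb, hne, hde'⟩
    -- both parents of the collider are also parents of `c`
    have key : ∀ x y, DirEdge H x b → UnshieldedCollider G x b y → DirEdge H x c := by
      intro x y hxb hc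
      rcases (hcl.adjacent hxb hbc).trichotomy with h1 | h1 | h1
      · exact h1
      · exact absurd hbc.symm (hcl.not_undirEdge h1 hxb)
      · exact absurd h1 (hcollider x b c y hc hbc)
    have hdc := key d e hdb hc
    have hec := key e d heb hc.symm
    rcases had.trichotomy with h1 | h1 | h1
    · exact hcl.not_undirEdge h1 hdc hac
    · rcases hae.trichotomy with h2 | h2 | h2
      · exact hcl.not_undirEdge h2 hec hac
      · exact hcol ⟨hs.adj hG h1, hs.adj hG h2⟩
      · exact hde (hcl.adjacent h1 h2)
    · rcases hae.trichotomy with h2 | h2 | h2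
      · exact hcl.not_undirEdge h2 hec hac
      · exact hde (hcl.adjacent h2 h1).symm
      · exact hR3 a c ⟨hac, d, e, hne, hde, h1, h2, hdc, hec⟩

/-- The invariant after the first phase, which ended with the mixed graph `E`; here `S` is the
set of nodes in large blocks at which the orientations have not been copied yet. -/
structure CopyPhase (P : Finpartition (Finset.univ : Finset V)) (G E : Digraph V) (S : Finset V)
    (H : Digraph V) : Prop where
  sound : Sound P G H
  subset : S ⊆ bigBlockNodes P
  not_undirEdge : ∀ v ∈ bigBlockNodes P, v ∉ S → ∀ x, ¬ UndirEdge H v x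
  undirEdge : ∀ a b, UndirEdge H a b → UndirEdge E a b
  reason : ∀ a b, DirEdge H a b → DirEdge E a b ∨ a ∈ bigBlockNodes P ∨ b ∈ bigBlockNodes P ∨
    ReasonR1 H a b ∨ ReasonR2 H a b

lemma PatternPhase.copyPhase (h : PatternPhase P G H) :
    CopyPhase P G H (bigBlockNodes P) H :=
  ⟨h.sound, subset_rfl, fun _ hv hv' => absurd hv hv', fun _ _ h => h, fun _ _ h => Or.inl h⟩

lemma CopyPhase.copyAt (hG : IsDAG G) {E : Digraph V} {S : Finset V} {v : V}
    (h : CopyPhase P G E S H) (hv : v ∈ S) :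
    CopyPhase P G E (S.erase v) (copyAt G H v) := by
  have hs := h.sound
  have hvb := h.subset hv
  have hdir : ∀ a b, DirEdge (PartialHomoscedasticity.copyAt G H v) a b ↔
      ((a = v ∨ b = v) ∧ G.Adj a b) ∨ (a ≠ v ∧ b ≠ v ∧ DirEdge H a b) := by
    intro a b
    have := hG.asymm (a := a) (b := b)
    simp only [DirEdge, PartialHomoscedasticity.copyAt]
    tauto
  have hundir : ∀ a b, UndirEdge (PartialHomoscedasticity.copyAt G H v) a b →
      a ≠ v ∧ b ≠ v ∧ UndirEdge H a b := by
    intro a b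
    have := hG.asymm (a := a) (b := b)
    simp only [UndirEdge, PartialHomoscedasticity.copyAt]
    tauto
  have hadj : ∀ a b, Adjacent (PartialHomoscedasticity.copyAt G H v) a b ↔ Adjacent H a b := by
    intro a b
    have := hs.adjacent_iff a b
    simp only [Adjacent, PartialHomoscedasticity.copyAt] at *
    tauto
  have hmono : ∀ a b, DirEdge H a b → DirEdge (PartialHomoscedasticity.copyAt G H v) a b := by
    intro a b hab
    have := hs.adj hG hab
    rw [hdir]
    tauto
  refine ⟨⟨fun a b => by rw [hadj, hs.adjacent_iff], fun D hD hDG a b hab => ?_,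
    fun a b c hc => hmono _ _ (hs.collider a b c hc)⟩, ?_, ?_, ?_, ?_⟩
  · rcases (hdir a b).1 hab with ⟨h1, h2⟩ | ⟨-, -, h1⟩
    · refine (hDG.adj_iff a b ?_).2 h2
      rcases h1 with rfl | rfl
      exacts [Or.inl hvb, Or.inr hvb]
    · exact hs.adj_of_dirEdge D hD hDG a b h1
  · exact (Finset.erase_subset v S).trans h.subset
  · intro x hx hxS y hxy
    obtain ⟨h1, -, h2⟩ := hundir x y hxy
    exact h.not_undirEdge x hx (fun h' => hxS (Finset.mem_erase.2 ⟨h1, h'⟩)) y h2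
  · exact fun a b hab => h.undirEdge a b (hundir a b hab).2.2
  · intro a b hab
    rcases (hdir a b).1 hab with ⟨rfl | rfl, -⟩ | ⟨-, -, h1⟩
    · exact Or.inr (Or.inl hvb)
    · exact Or.inr (Or.inr (Or.inl hvb))
    · exact (h.reason a b h1).imp id (Or.imp id (Or.imp id
        (Or.imp (ReasonR1.mono hmono hadj) (ReasonR2.mono hmono))))

lemma CopyPhase.step (hG : IsDAG G) {E H' : Digraph V} {S : Finset V}
    (h : CopyPhase P G E S H) (hstep : StepR12 H H') : CopyPhase P G E S H' := by
  obtain ⟨i, j, hr, rfl⟩ := hstep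
  have hu : UndirEdge H i j := by
    rcases hr with h | h <;> exact h.1
  have hij := h.sound.ne hG hu
  have hd : ∀ a b, DirEdge H a b → DirEdge (orient H i j) a b := fun a b h =>
    (dirEdge_orient_iff hu hij a b).2 (Or.inl h)
  have ha := adjacent_orient_iff hu hij
  refine ⟨h.sound.orient_of_rule hG (hr.imp id Or.inl), h.subset,
    fun v hv hvS x hx => h.not_undirEdge v hv hvS x hx.of_orient,
    fun a b hab => h.undirEdge a b hab.of_orient, fun a b hab => ?_⟩
  rcases (dirEdge_orient_iff hu hij a b).1 hab with hab | ⟨rfl, rfl⟩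
  · exact (h.reason a b hab).imp id (Or.imp id (Or.imp id
      (Or.imp (ReasonR1.mono hd ha) (ReasonR2.mono hd))))
  · exact Or.inr (Or.inr (Or.inr (hr.imp (fun hr => ReasonR1.mono hd ha hr.2)
      fun hr => ReasonR2.mono hd hr.2)))

/-- R1 and R2 suffice to restore the chain property after the orientations have been copied: in a
triangle `a → b - c - a` the nodes `a` and `b` lie in blocks of size one, and `a → b` was not
directed in `E`, which has the chain property. So it is justified by R1 or R2, which gives a
triangle with an earlier head. -/
lemma CopyPhase.chainProperty (hG : IsDAG G) {E : Digraph V} (hE : ChainProperty E)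
    (h : CopyPhase P G E ∅ H) (hcl : ClosedR12 H) : ChainProperty H := by
  have hs := h.sound
  obtain ⟨f, -, hf⟩ := exists_rank hG
  refine hcl.chainProperty fun a b c => ?_
  induction hn : f b using Nat.strong_induction_on generalizing a b with
  | _ n ih =>
  subst hn
  intro hab hbc hac
  rcases h.reason a b hab with h1 | h1 | h1 | ⟨d, hda, hdb⟩ | ⟨d, had, hdb⟩
  · exact (h.undirEdge _ _ hac).not_dirEdge (hE a b c h1 (h.undirEdge _ _ hbc))
  · exact h.not_undirEdge a h1 (Finset.notMem_empty a) c hac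
  · exact h.not_undirEdge b h1 (Finset.notMem_empty b) c hbc
  · exact ih (f a) (hf _ _ (hs.adj hG hab)) d a rfl hda hac
      (hcl.undirEdge_of_R1 hda hdb hbc hac)
  · exact ih (f d) (hf _ _ (hs.adj hG hdb)) a d rfl had
      (hcl.undirEdge_of_R2 had hdb hbc hac) hac

end Phases

/-! ### Runs of the algorithm -/

section Runs

variable {V : Type*} [Fintype V] [DecidableEq V] {P : Finpartition (Finset.univ : Finset V)}
  {G : Digraph V}

/-- The invariant of the states of the algorithm on the input `(G, P)`. -/
def StateInvariant (P : Finpartition (Finset.univ : Finset V)) (G : Digraph V) :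
    AlgState V → Prop
  | .start => True
  | .phase1 H => PatternPhase P G H
  | .loop S H => ∃ E, ChainProperty E ∧ CopyPhase P G E S H
  | .phase2 H => ∃ E, ChainProperty E ∧ CopyPhase P G E ∅ H
  | .output H => H = cpdag G P

lemma StateInvariant.step (hG : IsDAG G) {s t : AlgState V} (hs : StateInvariant P G s)
    (hst : AlgStep G P s t) : StateInvariant P G t := by
  cases hst with
  | init => exact patternPhase_patternGraph hG
  | orient1 H H' h => exact PatternPhase.step hG hs h
  | end1 H h => exact ⟨H, PatternPhase.chainProperty hG hs h, PatternPhase.copyPhase hs⟩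
  | copy S H v hv =>
    obtain ⟨E, hE, hs⟩ := hs
    exact ⟨E, hE, hs.copyAt hG hv⟩
  | endLoop H => exact hs
  | orient2 H H' h =>
    obtain ⟨E, hE, hs⟩ := hs
    exact ⟨E, hE, hs.step hG h⟩
  | ret H h =>
    obtain ⟨E, hE, hs⟩ := hs
    exact hs.sound.eq_cpdag hG (hs.chainProperty hG hE (closedR12_of_not_step h))
      fun a ha => hs.not_undirEdge a ha (Finset.notMem_empty a)

open Classical in
/-- The number of ordered pairs joined in `H`; directing an edge decreases it. -/
noncomputable def pairCount {V : Type*} [Fintype V] (H : Digraph V) : ℕ :=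
  (Finset.univ.filter (fun p : V × V => H.Adj p.1 p.2)).card

lemma pairCount_le {V : Type*} [Fintype V] (H : Digraph V) : pairCount H ≤ Fintype.card (V × V) :=
  Finset.card_le_univ _

lemma pairCount_orient_lt {H : Digraph V} {i j : V} (h : UndirEdge H i j) :
    pairCount (orient H i j) < pairCount H := by
  classical
  refine Finset.card_lt_card (Finset.ssubset_iff_of_subset ?_ |>.2 ⟨(j, i), ?_, ?_⟩)
  · intro p hp
    simp only [Finset.mem_filter, Finset.mem_univ, true_and] at hp ⊢
    exact hp.1
  · simpa using h.2
  · simp [orient]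

/-- A natural number that decreases with every step of the algorithm. -/
noncomputable def stateMeasure : AlgState V → ℕ
  | .start => 2 * Fintype.card (V × V) + Fintype.card V + 4
  | .phase1 H => Fintype.card (V × V) + Fintype.card V + 3 + pairCount H
  | .loop S _ => Fintype.card (V × V) + 2 + S.card
  | .phase2 H => 1 + pairCount H
  | .output _ => 0

lemma stateMeasure_lt {s t : AlgState V} (hst : AlgStep G P s t) :
    stateMeasure t < stateMeasure s := by
  cases hst with
  | init => have := pairCount_le (patternGraph G); simp only [stateMeasure]; omega
  | orient1 H H' h =>
    obtain ⟨i, j, hr, rfl⟩ := h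
    have := pairCount_orient_lt (H := H) (i := i) (j := j) (by
      rcases hr with h | h | h <;> exact h.1)
    simp only [stateMeasure]; omega
  | end1 H h =>
    have := Finset.card_le_univ (bigBlockNodes P)
    simp only [stateMeasure]; omega
  | copy S H v hv =>
    have := Finset.card_erase_lt_of_mem hv
    simp only [stateMeasure]; omega
  | endLoop H =>
    have := pairCount_le H
    simp only [stateMeasure, Finset.card_empty]; omega
  | orient2 H H' h =>
    obtain ⟨i, j, hr, rfl⟩ := h
    have := pairCount_orient_lt (H := H) (i := i) (j := j) (by
      rcases hr with h | h <;> exact h.1)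
    simp only [stateMeasure]; omega
  | ret H h => simp only [stateMeasure]; omega

lemma terminates : Terminates G P :=
  (Subrelation.wf (fun h => stateMeasure_lt h)
    (measure (stateMeasure (V := V))).wf).apply _

/-- A state without a successor is an output state. -/
lemma exists_eq_output {s : AlgState V} (hs : ∀ t, ¬ AlgStep G P s t) :
    ∃ H, s = .output H := by
  cases s with
  | start => exact absurd .init (hs _)
  | phase1 H =>
    by_cases h : ∃ H', StepR123 H H'
    · exact absurd (.orient1 H _ h.choose_spec) (hs _)
    · exact absurd (.end1 H fun H' h' => h ⟨H', h'⟩) (hs _)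
  | loop S H =>
    rcases S.eq_empty_or_nonempty with rfl | ⟨v, hv⟩
    · exact absurd (.endLoop H) (hs _)
    · exact absurd (.copy S H v hv) (hs _)
  | phase2 H =>
    by_cases h : ∃ H', StepR12 H H'
    · exact absurd (.orient2 H _ h.choose_spec) (hs _)
    · exact absurd (.ret H fun H' h' => h ⟨H', h'⟩) (hs _)
  | output H => exact ⟨H, rfl⟩

lemma FinalState.eq_output_cpdag (hG : IsDAG G) {s : AlgState V} (h : FinalState G P s) :
    s = .output (cpdag G P) := by
  obtain ⟨hreach, hstuck⟩ := h
  have hinv : StateInvariant P G s := by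
    clear hstuck
    induction hreach with
    | refl => trivial
    | tail _ hst ih => exact ih.step hG hst
  obtain ⟨H, rfl⟩ := exists_eq_output hstuck
  exact congrArg _ hinv

lemma exists_finalState : ∃ s, FinalState G P s := by
  obtain ⟨s, hs, hmin⟩ := (measure (stateMeasure (V := V))).wf.has_min
    {s | ReflTransGen (AlgStep G P) .start s} ⟨_, .refl⟩
  exact ⟨s, hs, fun t ht => hmin t (ReflTransGen.tail hs ht) (stateMeasure_lt ht)⟩

end Runs

end PartialHomoscedasticity

theorem theorem4p3 {V : Type*} [Fintype V] [DecidableEq V]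
    (G : Digraph V) (hG : PartialHomoscedasticity.IsDAG G)
    (P : Finpartition (Finset.univ : Finset V)) :
    PartialHomoscedasticity.Terminates G P ∧
      ∀ s : PartialHomoscedasticity.AlgState V,
        PartialHomoscedasticity.FinalState G P s ↔
          s = PartialHomoscedasticity.AlgState.output (PartialHomoscedasticity.cpdag G P) := by
  refine ⟨PartialHomoscedasticity.terminates, fun s => ⟨fun h => h.eq_output_cpdag hG, ?_⟩⟩
  rintro rfl
  obtain ⟨s, hs⟩ := PartialHomoscedasticity.exists_finalState (G := G) (P := P)
  exact hs.eq_output_cpdag hG ▸ hs
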